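/- A *$*$-probability space* is a pair $(\mathcal A,\varphi)$ of a unital complex $*$-algebra $\mathcal A$ and a state $\varphi$ on it, i.e. a linear functional with $\varphi(1)=1$ and $\varphi(a^*a)\ge 0$ for all $a\in\mathcal A$. An element $a\in\mathcal A$ is a *standard complex Gaussian variable* if $aa^*=a^*a$ and $\varphi(a^k a^{*l})=\mathbb E(Z^k\overline Z^{\,l})$ for all integers $k,l\ge 0$, where $Z=X+iY$ with $X,Y$ independent real Gaussian random variables of mean $0$ and variance $1/2$. Let $\{\tau_j\}_{j\in\mathbb Z}$ be independent real random variables with $\mathbb E\tau_j=0$, $\mathrm{Var}(\tau_j)=1$ and $\sup_{j}\mathbb E|\tau_j|^k<\infty$ for every integer $k\ge 0$, and let $T_n=(\tau_{j-i})_{0\le i,j\le n-1}$ be the non-symmetric Toeplitz matrix that they generate. Let $\mathcal M_n$ be the $*$-algebra of random complex $n\times n$ matrices whose entries have finite moments of all orders, and $\varphi_n=n^{-1}\mathbb E\,\mathrm{Tr}$. **Theorem.** $n^{-1/2}T_n\in\mathcal M_n$, and there are a $*$-probability space $(\mathcal A,\varphi)$ and standard complex Gaussian variables $N,\tilde N\in\mathcal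 A$ such that the following hold. 1. $n^{-1/2}T_n$ converges in $*$-distribution to $(N+\tilde N)/\sqrt2$: for every monomial $Q$ in two non-commuting indeterminates $x,x^*$, $$\lim_{n\to\infty}\varphi_n\big(Q(n^{-1/2}T_n)\big)=\varphi\big(Q((N+\tilde N)/\sqrt2)\big).$$ 2. The joint moments of $N$ and $\tilde N$ are finite sums of integrals over unit cubes, as follows. Let $w=a_0^{\epsilon_0}a_1^{\epsilon_1}\cdots a_{p-1}^{\epsilon_{p-1}}$ with $p\ge 0$, $a_s\in\{N,\tilde N\}$ and $\epsilon_s\in\{1,*\}$. Let $\Pi(w)$ be the set of pair partitions $\pi$ of $\{0,\dots,p-1\}$ such that $a_s=a_t$ and $\epsilon_s\ne\epsilon_t$ for every pair $\{s,t\}\in\pi$ (so $\Pi(w)=\emptyset$ for odd $p$). Then $$\varphi(w)=\sum_{\pi\in\Pi(w)}\int_{[0,1]^{p/2+1}}\exp\Big(i\pi_0\sum_{r=0}^{p}k_r\{l_r^{\pi}(x)\}\Big)\,dx .$$ Here $\pi_0=3.14159\ldots$, $\{\cdot\}$ is the fractional part, the coordinates of $x$ are $x_\ast$ and one $x_{s}$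 for each pair $\{s<t\}\in\pi$, $$l_r^{\pi}(x)=x_\ast+\sum_{\{s<t\}\in\pi}\big(\mathbf 1\{s<r\}-\mathbf 1\{t<r\}\big)x_{s},$$ and the integers $k_r$ are given by $k_r=\mathbf 1\{r\ge1,\ a_{r-1}=\tilde N\}-\mathbf 1\{r\le p-1,\ a_r=\tilde N\}$. 3. The joint moments are dominated by the standard Gaussian moments: $|\varphi(w)|\le\mathbb E(G^{p})$ for every $w$ as above, where $G$ is a standard real Gaussian random variable. -/

import Mathlib

open MeasureTheory ProbabilityTheory Filter Topology

noncomputable section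

/-- A non-commutative `*`-probability space: a unital complex `*`-algebra together with a state,
that is, a unital linear functional which is nonnegative on the elements `a* a`. -/
structure NCProbSpace where
  carrier : Type
  [ring : Ring carrier]
  [starRing : StarRing carrier]
  [algebra : Algebra ℂ carrier]
  [starModule : StarModule ℂ carrier]
  state : carrier →ₗ[ℂ] ℂ
  state_one : state 1 = 1
  state_nonneg : ∀ a : carrier,
    0 ≤ (state (star a * a)).re ∧ (state (star a * a)).im = 0

attribute [instance] NCProbSpace.ring NCProbSpace.starRing NCProbSpace.algebra
  NCProbSpace.starModule

/-- The value at the family `a` of a monomial in the non-commuting indeterminates `x i`, `(x i)*`.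
A monomial is the list of its letters from left to right;
the letter `(i, false)` is `x i` and the letter `(i, true)` is `(x i)*`. -/
def evalWord {ι A : Type*} [Ring A] [StarRing A] (a : ι → A) (w : List (ι × Bool)) : A :=
  (w.map fun l => if l.2 then star (a l.1) else a l.1).prod

/-- Convergence in `*`-distribution of the families `a n` to the family `b`:
all the joint `*`-moments converge. -/
def ConvergesInStarDist {ι : Type*} {A : ℕ → Type*} [∀ n, Ring (A n)] [∀ n, StarRing (A n)]
    (φ : ∀ n, A n → ℂ) (a : ∀ n, ι → A n) {B : Type*} [Ring B] [StarRing B]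
    (ψ : B → ℂ) (b : ι → B) : Prop :=
  ∀ w : List (ι × Bool),
    Tendsto (fun n => φ n (evalWord (a n) w)) atTop (𝓝 (ψ (evalWord b w)))

/-- A standard complex Gaussian variable of a `*`-probability space: a normal element `a` with
`φ (a ^ k * a* ^ l) = E (Z ^ k * conj Z ^ l)`, where `Z = X + i Y` with `X`, `Y` independent
real Gaussian of mean `0` and variance `1 / 2`. (Such an `a` is not self-adjoint,
as `E (Z ^ 2) = 0` and `E (Z * conj Z) = 1`.) -/
def IsStdComplexGaussian (𝒜 : NCProbSpace) (a : 𝒜.carrier) : Prop :=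
  a * star a = star a * a ∧
  ∀ k l : ℕ, 𝒜.state (a ^ k * star a ^ l) =
    ∫ z : ℝ × ℝ, ((z.1 : ℂ) + z.2 * Complex.I) ^ k *
        (starRingEnd ℂ ((z.1 : ℂ) + z.2 * Complex.I)) ^ l
      ∂((gaussianReal 0 (1 / 2)).prod (gaussianReal 0 (1 / 2)))

/-- The random variables `τ j` are independent, with zero mean, unit variance and
uniformly bounded moments of any order. -/
structure AssumptionI {Ω : Type*} [MeasurableSpace Ω] (P : Measure Ω) (τ : ℤ → Ω → ℝ) :
    Prop where
  measurable : ∀ j, Measurable (τ j)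
  indep : iIndepFun τ P
  integrable_pow : ∀ (k : ℕ) (j : ℤ), Integrable (fun ω => |τ j ω| ^ k) P
  mean_zero : ∀ j, ∫ ω, τ j ω ∂P = 0
  variance_one : ∀ j, variance (τ j) P = 1
  bounded_moments : ∀ k : ℕ, ∃ C : ℝ, ∀ j, ∫ ω, |τ j ω| ^ k ∂P ≤ C

/-- Membership in `ℳ n`: all the entries of the random matrix have finite moments of all orders. -/
def HasAllMoments {Ω : Type*} [MeasurableSpace Ω] (P : Measure Ω) {n : ℕ}
    (M : Ω → Matrix (Fin n) (Fin n) ℂ) : Prop :=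
  ∀ (i j : Fin n) (k : ℕ), MemLp (fun ω => M ω i j) k P

/-- The functional `n⁻¹ E Tr` on random `n × n` matrices. -/
def expTrace {Ω : Type*} [MeasurableSpace Ω] (P : Measure Ω) (n : ℕ)
    (M : Ω → Matrix (Fin n) (Fin n) ℂ) : ℂ :=
  (n : ℂ)⁻¹ * ∫ ω, (M ω).trace ∂P

/-- The random Toeplitz matrix `(τ (j - i))`, `0 ≤ i, j ≤ n - 1`. -/
def toeplitz {Ω : Type*} (τ : ℤ → Ω → ℝ) (n : ℕ) : Ω → Matrix (Fin n) (Fin n) ℂ :=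
  fun ω => Matrix.of fun i j => ((τ ((j : ℤ) - (i : ℤ)) ω : ℝ) : ℂ)

/-- The integral over the unit cube `[0, 1] ^ ι` of `exp (i θ ∑ r, k r * {l r (x)})`, where the
`k r` are integers, the `l r` are linear forms with integer coefficients, `l r v` being the
coefficient of `x v`, and `{·}` is the fractional part. -/
def fractExpIntegral (θ : ℝ) {ι J : Type*} [Fintype ι] [Fintype J]
    (k : J → ℤ) (l : J → ι → ℤ) : ℂ :=
  ∫ x in Set.Icc (0 : ι → ℝ) 1,
    Complex.exp (Complex.I * θ * ((∑ r, (k r : ℝ) * Int.fract (∑ v, (l r v : ℝ) * x v) : ℝ) : ℂ))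

/-- The pair partitions of the positions of the word `w` in which every pair joins some `x i`
with the corresponding `(x i)*`; a pair partition is given as the involution without fixed points
that exchanges the two elements of each pair. -/
def matchedPairings (w : List (Fin 2 × Bool)) : Finset (Equiv.Perm (Fin w.length)) :=
  Finset.univ.filter fun π => ∀ s, π (π s) = s ∧ π s ≠ s ∧
    (w.get (π s)).1 = (w.get s).1 ∧ (w.get (π s)).2 ≠ (w.get s).2

/-- The linear forms of a pair partition `π` of `p` points. There is one variable `x none` and one
variable `x (some s)` for every pair `s < π s`, and, for `r = 0, …, p`,
`l r (x) = x none + ∑ s, (1 {s < r} - 1 {π s < r}) * x (some s)`. -/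
def pairingForm {p : ℕ} (π : Equiv.Perm (Fin p)) (r : Fin (p + 1)) :
    Option {s : Fin p // s < π s} → ℤ
  | none => 1
  | some s => (if s.1.castSucc < r then 1 else 0) - (if (π s.1).castSucc < r then 1 else 0)

/-- The integer coefficients of the phase of the word `w`: each position `s` that carries the
second variable or its adjoint contributes `1` at `s + 1` and `-1` at `s`. -/
def phaseCoeff (w : List (Fin 2 × Bool)) (r : Fin (w.length + 1)) : ℤ :=
  ∑ s : Fin w.length, if (w.get s).1 = 1 then
    (if r = s.succ then 1 else 0) - (if r = s.castSucc then 1 else 0) else 0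

end

/-! The entry of a Toeplitz matrix depends on the integer `j - i`, that of a circulant only on its
residue modulo `n`. `N` and `N'` are the limits of two independent random matrices: a circulant, and
a skew-circulant, which is a circulant conjugated by the diagonal unitary with entries exp(iπj/n).

Expand the normalized trace of a word of length p over closed paths in `Fin n`. Independence and
zero means kill every path on which some index occurs once, and the factor n^(-1-p/2) kills the
paths with fewer than p/2 distinct indices. What remains is a sum over pair partitions of
(phase-weighted) counts of paths whose signed steps agree on the pairs
(`norm_prod_fiber_sub_card_le`, `tendsto_sum_paths_sub`). In the Toeplitz case a pair of equal signs
costs a degree of freedom (`card_closedPaths_pairing_le`). In the model the entries are fourth roots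
of unity ξ, with E ξ² = 0 and E |ξ|² = 1. So in both cases only pairs that join a letter with an
adjoint survive.

The link between the two is `sum_labels_pathPhase`. If the signed steps of such a pair agree modulo
n, the two raw steps add up to 0 or ±n, so their phases multiply to 1 or -1, and one plus this
product is 2 or 0. Hence the indicator of agreement in the integers is 2^(-p/2) times the sum of the
path phases over the labellings by {circulant, skew-circulant} that are constant on pairs. This is
the expansion of a word in (N + N')/√2.

Paths matched modulo n are parametrized by p/2 + 1 grid coordinates (`sum_matched_closedPaths`).
Reduction modulo n becomes a fractional part, and the normalized sums are Riemann sums of the stated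
integrals (`tendsto_gridSum`).

The state is the limit of n⁻¹ E Tr on the algebra generated by the model sequences. Positivity
passes to the limit, and normality is exact for each n. For a single variable the phases telescope,
every integral is 1, and the moment counts the bijections between letters and adjoints: k! if k = l,
else 0. Finally each integral has modulus at most 1, and the number of pair partitions is at most
the Gaussian moment. -/

/-! ### Pair partitions and products over fibers. -/

/-- The pair partitions of `p` points, as involutions without fixed points. -/
def pairings (p : ℕ) : Finset (Equiv.Perm (Fin p)) :=
  Finset.univ.filter fun π => ∀ s, π (π s) = s ∧ π s ≠ s

theorem mem_pairings {p : ℕ} {π : Equiv.Perm (Fin p)} :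
    π ∈ pairings p ↔ ∀ s, π (π s) = s ∧ π s ≠ s := by
  simp [pairings]

/-- A map whose fibers all have two elements is constant on the pairs of exactly one pair
partition. -/
theorem exists_pairing_of_card_fiber_eq_two {p : ℕ} {V : Type*} [DecidableEq V] (d : Fin p → V)
    (h : ∀ s, (Finset.univ.filter fun t => d t = d s).card = 2) :
    ∃ σ ∈ pairings p, ∀ s, (Finset.univ.filter fun t => d t = d s) = {s, σ s} := by
  have h1 : ∀ s, ∃ t, t ≠ s ∧ (Finset.univ.filter fun t => d t = d s) = {s, t} := by
    intro s
    have hs : s ∈ Finset.univ.filter fun t => d t = d s := by simp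
    obtain ⟨a, b, hab, he⟩ := Finset.card_eq_two.1 (h s)
    rw [he] at hs
    simp only [Finset.mem_insert, Finset.mem_singleton] at hs
    rcases hs with rfl | rfl
    · exact ⟨b, hab.symm, he⟩
    · exact ⟨a, hab, by rw [he, Finset.pair_comm]⟩
  choose f hf hfe using h1
  have hd : ∀ s, d (f s) = d s := by
    intro s
    have : f s ∈ Finset.univ.filter fun t => d t = d s := by rw [hfe]; simp
    simpa using this
  have hff : ∀ s, f (f s) = s := by
    intro s
    have h2 := hfe (f s)
    rw [hd, hfe s] at h2
    have : s ∈ ({f s, f (f s)} : Finset (Fin p)) := by rw [← h2]; simp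
    simp only [Finset.mem_insert, Finset.mem_singleton] at this
    rcases this with h3 | h3
    · exact absurd h3.symm (hf s)
    · exact h3.symm
  exact ⟨⟨f, f, hff, hff⟩, mem_pairings.2 fun s => ⟨hff s, hf s⟩, hfe⟩

/-- A product of functions of the fibers of `d` that vanish on singletons is the number of pair
partitions compatible with `d`, up to an error that vanishes unless `d` has few values. -/
theorem norm_prod_fiber_sub_card_le {p : ℕ} {V : Type*} [DecidableEq V] (d : Fin p → V)
    (μ : V → Finset (Fin p) → ℂ) (c : Fin p → Fin p → Prop) [∀ s t, Decidable (c s t)]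
    {K : ℝ} (hK1 : 1 ≤ K) (h1 : ∀ v s, μ v {s} = 0)
    (h2 : ∀ v s t, s ≠ t → μ v {s, t} = if c s t then 1 else 0) (hK : ∀ v S, ‖μ v S‖ ≤ K) :
    ‖∏ v ∈ Finset.univ.image d, μ v (Finset.univ.filter fun s => d s = v) -
      (((pairings p).filter fun π => (∀ s, d (π s) = d s) ∧ ∀ s, c s (π s)).card : ℂ)‖ ≤
    if 2 * (Finset.univ.image d).card < p then K ^ p + (p.factorial : ℝ) else 0 := by
  split_ifs with hlt
  · refine (norm_sub_le _ _).trans (add_le_add ?_ ?_)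
    · rw [norm_prod]
      calc ∏ v ∈ Finset.univ.image d, ‖μ v (Finset.univ.filter fun s => d s = v)‖
          ≤ ∏ v ∈ Finset.univ.image d, K := Finset.prod_le_prod (fun _ _ => norm_nonneg _)
            (fun v _ => hK _ _)
        _ = K ^ (Finset.univ.image d).card := by simp
        _ ≤ K ^ p := pow_le_pow_right₀ hK1 (by omega)
    · simp only [Complex.norm_natCast, Nat.cast_le]
      refine (Finset.card_le_univ _).trans ?_
      simp [Fintype.card_perm]
  -- With at least p/2 values the identity is exact. A singleton fiber makes both sides vanish.
  · rw [norm_le_zero_iff, sub_eq_zero]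
    by_cases hs : ∃ s, (Finset.univ.filter fun t => d t = d s).card = 1
    · obtain ⟨s, hs⟩ := hs
      have hs' : (Finset.univ.filter fun t => d t = d s) = {s} := by
        obtain ⟨a, ha⟩ := Finset.card_eq_one.1 hs
        have : s ∈ Finset.univ.filter fun t => d t = d s := by simp
        rw [ha, Finset.mem_singleton] at this
        rw [ha, this]
      rw [Finset.prod_eq_zero (i := d s) (by simp) (by rw [hs', h1]), Finset.filter_eq_empty_iff.2]
      · simp
      · rintro π hπ ⟨h3, -⟩
        have : π s ∈ Finset.univ.filter fun t => d t = d s := by simp [h3]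
        rw [hs', Finset.mem_singleton] at this
        exact (mem_pairings.1 hπ s).2 this
    -- All fibers now have size at least 2 and the sizes sum to p, at most twice the number of
    -- fibers. So all sizes are 2 and the fibers themselves form the only pair partition compatible
    -- with `d`.
    · push Not at hs
      have hge : ∀ v ∈ Finset.univ.image d, 2 ≤ (Finset.univ.filter fun t => d t = v).card := by
        intro v hv
        obtain ⟨s, -, rfl⟩ := Finset.mem_image.1 hv
        have : 0 < (Finset.univ.filter fun t => d t = d s).card :=
          Finset.card_pos.2 ⟨s, by simp⟩
        have := hs s
        omega
      have hsum : ∑ v ∈ Finset.univ.image d, (Finset.univ.filter fun t => d t = v).card = p := by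
        rw [← Finset.card_eq_sum_card_image]; simp
      have heq : ∀ v ∈ Finset.univ.image d, 2 = (Finset.univ.filter fun t => d t = v).card := by
        refine (Finset.sum_eq_sum_iff_of_le hge).1 ?_
        apply le_antisymm (Finset.sum_le_sum hge)
        rw [hsum]; simp; omega
      obtain ⟨σ, hσ, hσe⟩ := exists_pairing_of_card_fiber_eq_two d
        (fun s => (heq (d s) (by simp)).symm)
      have hdσ : ∀ s, d (σ s) = d s := by
        intro s
        have : σ s ∈ Finset.univ.filter fun t => d t = d s := by rw [hσe]; simp
        simpa using this
      have huniq : ∀ π ∈ pairings p, (∀ s, d (π s) = d s) → π = σ := by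
        intro π hπ h3
        ext s
        have : π s ∈ Finset.univ.filter fun t => d t = d s := by simp [h3]
        rw [hσe] at this
        simp only [Finset.mem_insert, Finset.mem_singleton] at this
        rcases this with h4 | h4
        · exact absurd h4 (mem_pairings.1 hπ s).2
        · rw [h4]
      have hval : ∀ s, μ (d s) (Finset.univ.filter fun t => d t = d s) =
          if c s (σ s) then 1 else 0 := by
        intro s
        rw [hσe, h2 _ _ _ (mem_pairings.1 hσ s).2.symm]
      by_cases hc : ∀ s, c s (σ s)
      · rw [Finset.prod_eq_one, Finset.card_eq_one.2 ⟨σ, _⟩]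
        · simp
        · ext π
          simp only [Finset.mem_filter, Finset.mem_singleton]
          constructor
          · exact fun h => huniq π h.1 h.2.1
          · rintro rfl
            exact ⟨hσ, hdσ, hc⟩
        · intro v hv
          obtain ⟨s, -, rfl⟩ := Finset.mem_image.1 hv
          rw [hval, if_pos (hc s)]
      · push Not at hc
        obtain ⟨s, hs⟩ := hc
        rw [Finset.prod_eq_zero (i := d s) (by simp) (by rw [hval, if_neg hs]),
          Finset.filter_eq_empty_iff.2]
        · simp
        · rintro π hπ ⟨h3, h4⟩
          exact hs (huniq π hπ h3 ▸ h4 s)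

/-! ### Counting families with few values. -/

/-- A family determined by one coordinate in `Fin n` and the values of `D` on `R` is small. -/
theorem card_le_of_determined {α : Type*} {p n : ℕ} {V : Type*} (X : Finset α) (h : α → Fin n)
    (D : α → Fin p → V) (W : Finset V) (hW : ∀ x ∈ X, ∀ s, D x s ∈ W) (R : Finset (Fin p))
    (hinj : ∀ x ∈ X, ∀ y ∈ X, h x = h y → (∀ s ∈ R, D x s = D y s) → x = y) :
    X.card ≤ n * W.card ^ R.card := by
  classical
  let F : X → Fin n × (R → W) := fun x => (h x.1, fun s => ⟨D x.1 s.1, hW x.1 x.2 s.1⟩)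
  have hF : Function.Injective F := by
    intro x y hxy
    simp only [F, Prod.mk.injEq] at hxy
    apply Subtype.ext
    refine hinj x.1 x.2 y.1 y.2 hxy.1 fun s hs => ?_
    have := congrFun hxy.2 ⟨s, hs⟩
    simpa using this
  have := Fintype.card_le_of_injective F hF
  simpa using this

/-- There are few members of a family for which `D` takes less than `p / 2` values. -/
theorem card_few_values_le {α : Type*} {p n : ℕ} {V : Type*} [DecidableEq V] (X : Finset α)
    (h : α → Fin n) (D : α → Fin p → V) (W : Finset V) (hW : ∀ x ∈ X, ∀ s, D x s ∈ W)
    (hinj : ∀ x ∈ X, ∀ y ∈ X, h x = h y → (∀ s, D x s = D y s) → x = y)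
    (hWc : W.card ≤ 3 * n) :
    ((X.filter fun x => 2 * (Finset.univ.image (D x)).card < p).card : ℝ) ≤
      (p ^ p * 3 ^ p : ℕ) * (n * Real.sqrt n ^ (p - 1)) := by
  classical
  rcases Nat.eq_zero_or_pos n with rfl | hn
  · have : X = ∅ := Finset.eq_empty_of_forall_notMem fun x _ => (h x).elim0
    simp [this]
  -- Each value of `d` gets a representative position. The union bound then runs over the at most
  -- p^p maps `f`, and the data are determined by their values on the image of `f`.
  have hex : ∀ d : Fin p → V, ∃ f : Fin p → Fin p, (∀ s, d (f s) = d s) ∧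
      (Finset.univ.image f).card = (Finset.univ.image d).card := by
    intro d
    -- `Option` supplies a default off the range of `d`, since `Fin p` may be empty.
    have : ∀ v : V, ∃ s : Option (Fin p), v ∈ Finset.univ.image d → ∃ t, s = some t ∧ d t = v := by
      intro v
      by_cases hv : v ∈ Finset.univ.image d
      · obtain ⟨t, -, ht⟩ := Finset.mem_image.1 hv
        exact ⟨some t, fun _ => ⟨t, rfl, ht⟩⟩
      · exact ⟨none, fun h => absurd h hv⟩
    choose r hr using this
    have hr' : ∀ s, ∃ t, r (d s) = some t ∧ d t = d s := fun s => hr _ (by simp)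
    choose f hf hfd using hr'
    refine ⟨f, hfd, ?_⟩
    have him : (Finset.univ.image f).image d = Finset.univ.image d := by
      rw [Finset.image_image]; congr 1; ext s; exact hfd s
    rw [← him]
    refine (Finset.card_image_of_injOn ?_).symm
    intro a ha b hb hab
    simp only [Finset.coe_image, Set.mem_image, Finset.coe_univ, Set.mem_univ, true_and] at ha hb
    obtain ⟨s, rfl⟩ := ha
    obtain ⟨t, rfl⟩ := hb
    have : d s = d t := by rw [← hfd s, ← hfd t]; exact hab
    have h4 := hf s
    rw [this, hf t] at h4
    exact (Option.some.inj h4).symm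
  have hsub : (X.filter fun x => 2 * (Finset.univ.image (D x)).card < p) ⊆
      (Finset.univ.filter fun f : Fin p → Fin p => 2 * (Finset.univ.image f).card < p).biUnion
        fun f => X.filter fun x => ∀ s, D x (f s) = D x s := by
    intro x hx
    obtain ⟨hx1, hx2⟩ := Finset.mem_filter.1 hx
    obtain ⟨f, hf1, hf2⟩ := hex (D x)
    simp only [Finset.mem_biUnion, Finset.mem_filter, Finset.mem_univ, true_and]
    exact ⟨f, by rw [hf2]; exact hx2, hx1, hf1⟩
  have hs1 : (1 : ℝ) ≤ Real.sqrt n := Real.one_le_sqrt.2 (by exact_mod_cast hn)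
  have hone : ∀ f ∈ (Finset.univ.filter fun f : Fin p → Fin p =>
      2 * (Finset.univ.image f).card < p),
      ((X.filter fun x => ∀ s, D x (f s) = D x s).card : ℝ) ≤
        3 ^ p * (n * Real.sqrt n ^ (p - 1)) := by
    intro f hf
    simp only [Finset.mem_filter, Finset.mem_univ, true_and] at hf
    have h5 := card_le_of_determined (X.filter fun x => ∀ s, D x (f s) = D x s) h D W
      (fun x hx => hW x (Finset.mem_filter.1 hx).1) (Finset.univ.image f) (by
        intro x hx y hy hxy hR
        obtain ⟨hx1, hx2⟩ := Finset.mem_filter.1 hx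
        obtain ⟨hy1, hy2⟩ := Finset.mem_filter.1 hy
        refine hinj x hx1 y hy1 hxy fun s => ?_
        rw [← hx2, ← hy2]
        exact hR _ (by simp))
    set b := (Finset.univ.image f).card
    calc ((X.filter fun x => ∀ s, D x (f s) = D x s).card : ℝ)
        ≤ ((n * W.card ^ b : ℕ) : ℝ) := by exact_mod_cast h5
      _ ≤ ((n * (3 * n) ^ b : ℕ) : ℝ) := by
          exact_mod_cast Nat.mul_le_mul_left _ (Nat.pow_le_pow_left hWc b)
      _ = 3 ^ b * (n * Real.sqrt n ^ (2 * b)) := by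
          rw [pow_mul, Real.sq_sqrt (by positivity)]; push_cast; ring
      -- Here 2b < p, so 2b ≤ p - 1. This loses a factor √n against the normalization n · √n ^ p.
      _ ≤ 3 ^ p * (n * Real.sqrt n ^ (p - 1)) := by
          gcongr
          · norm_num
          · omega
          · omega
  calc ((X.filter fun x => 2 * (Finset.univ.image (D x)).card < p).card : ℝ)
      ≤ ∑ f ∈ (Finset.univ.filter fun f : Fin p → Fin p => 2 * (Finset.univ.image f).card < p),
        ((X.filter fun x => ∀ s, D x (f s) = D x s).card : ℝ) := by
        exact_mod_cast (Finset.card_le_card hsub).trans Finset.card_biUnion_le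
    _ ≤ ∑ f ∈ (Finset.univ.filter fun f : Fin p → Fin p => 2 * (Finset.univ.image f).card < p),
        3 ^ p * (n * Real.sqrt n ^ (p - 1)) := Finset.sum_le_sum hone
    _ ≤ _ := by
        rw [Finset.sum_const, nsmul_eq_mul]
        push_cast
        rw [mul_assoc]
        gcongr
        have := Finset.card_le_univ (Finset.univ.filter fun f : Fin p → Fin p =>
          2 * (Finset.univ.image f).card < p)
        simp only [Fintype.card_fun, Fintype.card_fin] at this
        exact_mod_cast this

/-! ### Closed paths and their signed steps. -/

/-- The closed paths of length `p` in `Fin n`. -/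
def closedPaths (p n : ℕ) : Finset (Fin (p + 1) → Fin n) :=
  Finset.univ.filter fun x => x 0 = x (Fin.last p)

theorem mem_closedPaths {p n : ℕ} {x : Fin (p + 1) → Fin n} :
    x ∈ closedPaths p n ↔ x 0 = x (Fin.last p) := by
  simp [closedPaths]

/-- The steps of a path, as integers, with the sign changed at the positions marked by `ε`. -/
def zstep {p n : ℕ} (ε : Fin p → Bool) (x : Fin (p + 1) → Fin n) (s : Fin p) : ℤ :=
  if ε s then (x s.castSucc : ℤ) - (x s.succ : ℤ) else (x s.succ : ℤ) - (x s.castSucc : ℤ)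

/-- The steps of a path modulo `n`, with the sign changed at the positions marked by `ε`. -/
def mstep {p n : ℕ} (ε : Fin p → Bool) (x : Fin (p + 1) → Fin n) (s : Fin p) : Fin n :=
  if ε s then x s.castSucc - x s.succ else x s.succ - x s.castSucc

/-- Subtraction in `Fin n` differs from integer subtraction by 0 or n, and two representatives in
[0, n) congruent modulo n coincide. -/
theorem Fin.sub_eq_sub_iff_intCast_dvd {n : ℕ} (i j k l : Fin n) :
    j - i = l - k ↔ (n : ℤ) ∣ ((j : ℤ) - i) - ((l : ℤ) - k) := by
  have h1 := Fin.intCast_val_sub_eq_sub_add_ite j i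
  have h2 := Fin.intCast_val_sub_eq_sub_add_ite l k
  have h3 := (j - i).isLt
  have h4 := (l - k).isLt
  constructor
  · intro h
    rw [h] at h1
    split_ifs at h1 h2 <;> push_cast at h1 h2
    · exact ⟨0, by linarith⟩
    · exact ⟨1, by linarith⟩
    · exact ⟨-1, by linarith⟩
    · exact ⟨0, by linarith⟩
  · intro h
    have h5 : (n : ℤ) ∣ ((j - i : Fin n) : ℤ) - ((l - k : Fin n) : ℤ) := by
      obtain ⟨c, hc⟩ := h
      split_ifs at h1 h2 <;> push_cast at h1 h2
      · exact ⟨c, by linarith⟩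
      · exact ⟨c - 1, by linarith⟩
      · exact ⟨c + 1, by linarith⟩
      · exact ⟨c, by linarith⟩
    have h6 := Int.eq_zero_of_abs_lt_dvd h5 (by rw [abs_lt]; constructor <;> omega)
    apply Fin.ext
    omega

theorem mstep_eq_iff {p n : ℕ} (ε : Fin p → Bool) (x : Fin (p + 1) → Fin n) (s t : Fin p) :
    mstep ε x s = mstep ε x t ↔ (n : ℤ) ∣ zstep ε x s - zstep ε x t := by
  unfold mstep zstep
  split_ifs <;> exact Fin.sub_eq_sub_iff_intCast_dvd _ _ _ _

theorem path_ext_of_mstep {p n : ℕ} {ε : Fin p → Bool} {x y : Fin (p + 1) → Fin n}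
    (h0 : x 0 = y 0) (h : ∀ s, mstep ε x s = mstep ε y s) : x = y := by
  have : NeZero n := ⟨fun hn => by subst hn; exact (x 0).elim0⟩
  funext r
  induction r using Fin.induction with
  | zero => exact h0
  | succ s ih =>
    have h1 := h s
    unfold mstep at h1
    rw [ih] at h1
    split_ifs at h1
    · exact sub_right_injective h1
    · exact sub_left_injective h1

theorem mstep_eq_of_zstep_eq {p n : ℕ} {ε : Fin p → Bool} {x y : Fin (p + 1) → Fin n} {s : Fin p}
    (h : zstep ε x s = zstep ε y s) : mstep ε x s = mstep ε y s := by
  unfold zstep at h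
  unfold mstep
  split_ifs at h ⊢ <;> rw [Fin.sub_eq_sub_iff_intCast_dvd] <;> exact ⟨0, by linarith⟩

theorem path_ext_of_zstep {p n : ℕ} {ε : Fin p → Bool} {x y : Fin (p + 1) → Fin n}
    (h0 : x 0 = y 0) (h : ∀ s, zstep ε x s = zstep ε y s) : x = y :=
  path_ext_of_mstep h0 fun s => mstep_eq_of_zstep_eq (h s)

/-- The strict bound matters: two integer steps differ by less than 2n in absolute value, so if they
agree modulo n, they differ by 0 or ±n. -/
theorem abs_zstep_lt {p n : ℕ} (ε : Fin p → Bool) (x : Fin (p + 1) → Fin n) (s : Fin p) :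
    |zstep ε x s| < n := by
  unfold zstep
  have h1 := (x s.castSucc).isLt
  have h2 := (x s.succ).isLt
  rw [abs_lt]
  split_ifs <;> constructor <;> omega

theorem zstep_mem_Icc {p n : ℕ} (ε : Fin p → Bool) (x : Fin (p + 1) → Fin n) (s : Fin p) :
    zstep ε x s ∈ Finset.Icc (-(n : ℤ)) n := by
  have := abs_lt.1 (abs_zstep_lt ε x s)
  rw [Finset.mem_Icc]
  omega

theorem card_Icc_neg_le (n : ℕ) (hn : 0 < n) : (Finset.Icc (-(n : ℤ)) n).card ≤ 3 * n := by
  rw [Int.card_Icc]; omega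

/-- The sum telescopes around the closed path. This is the one linear relation between the steps. -/
theorem sum_sign_zstep {p n : ℕ} (ε : Fin p → Bool) {x : Fin (p + 1) → Fin n}
    (hx : x ∈ closedPaths p n) :
    ∑ s, (if ε s then (-1 : ℤ) else 1) * zstep ε x s = 0 := by
  have h1 : ∀ s, (if ε s then (-1 : ℤ) else 1) * zstep ε x s =
      (x s.succ : ℤ) - (x s.castSucc : ℤ) := by
    intro s
    unfold zstep
    split_ifs <;> ring
  rw [Finset.sum_congr rfl fun s _ => h1 s, Finset.sum_sub_distrib]
  have h2 := Fin.sum_univ_succ fun r => (x r : ℤ)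
  have h3 := Fin.sum_univ_castSucc fun r => (x r : ℤ)
  rw [mem_closedPaths.1 hx] at h2
  linarith

/-! ### Splitting over pairs, and the cost of a pair of equal signs. -/

theorem prod_eq_prod_pairs {p : ℕ} {π : Equiv.Perm (Fin p)} (hπ : π ∈ pairings p) {M : Type*}
    [CommMonoid M] (f : Fin p → M) :
    ∏ s, f s = ∏ s : {s : Fin p // s < π s}, f s.1 * f (π s.1) := by
  rw [← Finset.prod_filter_mul_prod_filter_not Finset.univ (fun s => s < π s) f,
    Finset.prod_mul_distrib]
  congr 1
  · exact Finset.prod_subtype _ (by simp) _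
  · rw [← Finset.prod_subtype (Finset.univ.filter fun s => s < π s) (by simp)
      (fun s => f (π s))]
    refine Finset.prod_nbij' π π ?_ ?_ ?_ ?_ ?_
    · intro s hs
      simp only [Finset.mem_filter, Finset.mem_univ, true_and] at hs ⊢
      rw [(mem_pairings.1 hπ s).1]
      exact lt_of_le_of_ne (not_lt.1 hs) (mem_pairings.1 hπ s).2
    · intro s hs
      simp only [Finset.mem_filter, Finset.mem_univ, true_and] at hs ⊢
      rw [(mem_pairings.1 hπ s).1]
      exact hs.not_gt
    · exact fun s _ => (mem_pairings.1 hπ s).1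
    · exact fun s _ => (mem_pairings.1 hπ s).1
    · exact fun s _ => by rw [(mem_pairings.1 hπ s).1]

theorem two_mul_card_pairs {p : ℕ} {π : Equiv.Perm (Fin p)} (hπ : π ∈ pairings p) :
    2 * Fintype.card {s : Fin p // s < π s} = p := by
  have h := prod_eq_prod_pairs hπ (M := Multiplicative ℕ) fun _ => Multiplicative.ofAdd 1
  simp only [Finset.prod_const, Finset.card_univ, Fintype.card_fin, ← ofAdd_nsmul,
    ← ofAdd_add] at h
  have h2 := Multiplicative.ofAdd.injective h
  simp at h2
  omega

/-- A pair of equal signs costs one degree of freedom. -/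
theorem card_closedPaths_pairing_le {p n : ℕ} {π : Equiv.Perm (Fin p)} (hπ : π ∈ pairings p)
    (ε : Fin p → Bool) (hε : ∃ s, ε (π s) = ε s) :
    (((closedPaths p n).filter fun x => ∀ s, zstep ε x (π s) = zstep ε x s).card : ℝ) ≤
      3 ^ p * (n * Real.sqrt n ^ (p - 1)) := by
  classical
  rcases Nat.eq_zero_or_pos n with rfl | hn
  · rw [Finset.card_eq_zero.2 (Finset.eq_empty_of_forall_notMem fun x _ => (x 0).elim0)]
    simp
  obtain ⟨t, ht, hεt⟩ : ∃ t, t < π t ∧ ε (π t) = ε t := by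
    obtain ⟨s, hs⟩ := hε
    rcases lt_or_gt_of_ne (mem_pairings.1 hπ s).2 with h | h
    · exact ⟨π s, by rwa [(mem_pairings.1 hπ s).1], by rw [(mem_pairings.1 hπ s).1, hs]⟩
    · exact ⟨s, h, hs⟩
  -- One step per pair, except for the pair of `t`: its two equal signs enter the closing relation
  -- as ±2 times the step at `t`, which is thus determined by the others. So 2|R| = p - 2.
  set R := (Finset.univ.filter fun s => s < π s).erase t
  have hR : 2 * (R.card + 1) = p := by
    rw [Finset.card_erase_add_one (by simpa using ht), ← Fintype.card_subtype,
      two_mul_card_pairs hπ]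
  have h5 := card_le_of_determined
    ((closedPaths p n).filter fun x => ∀ s, zstep ε x (π s) = zstep ε x s)
    (fun x => x 0) (zstep ε) (Finset.Icc (-(n : ℤ)) n) (fun x _ => zstep_mem_Icc ε x) R (by
      intro x hx y hy hxy hs
      obtain ⟨hx1, hx2⟩ := Finset.mem_filter.1 hx
      obtain ⟨hy1, hy2⟩ := Finset.mem_filter.1 hy
      have key : ∀ s, s ≠ t ∧ s ≠ π t → zstep ε x s = zstep ε y s := by
        intro s hst
        rcases lt_or_gt_of_ne (mem_pairings.1 hπ s).2 with h | h
        · rw [← hx2, ← hy2]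
          refine hs _ (Finset.mem_erase.2 ⟨fun h' => hst.2 ?_, by simpa [(mem_pairings.1 hπ s).1]⟩)
          rw [← h', (mem_pairings.1 hπ s).1]
        · exact hs _ (Finset.mem_erase.2 ⟨hst.1, by simpa using h⟩)
      have hsum : ∑ s, (if ε s then (-1 : ℤ) else 1) * (zstep ε x s - zstep ε y s) = 0 := by
        simp only [mul_sub, Finset.sum_sub_distrib, sum_sign_zstep ε hx1, sum_sign_zstep ε hy1,
          sub_zero]
      rw [Fintype.sum_eq_add t (π t) ht.ne (fun s hst => by rw [key s hst]; ring), hεt, hx2,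
        hy2] at hsum
      have ht' : zstep ε x t = zstep ε y t := by
        split_ifs at hsum <;> linarith
      refine path_ext_of_zstep (ε := ε) hxy fun s => ?_
      by_cases h1 : s = t
      · rw [h1, ht']
      by_cases h2 : s = π t
      · rw [h2, hx2, hy2, ht']
      · exact key s ⟨h1, h2⟩)
  have hs1 : (1 : ℝ) ≤ Real.sqrt n := Real.one_le_sqrt.2 (by exact_mod_cast hn)
  calc _ ≤ ((n * (Finset.Icc (-(n : ℤ)) n).card ^ R.card : ℕ) : ℝ) := by exact_mod_cast h5
    _ ≤ ((n * (3 * n) ^ R.card : ℕ) : ℝ) := by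
        exact_mod_cast Nat.mul_le_mul_left _ (Nat.pow_le_pow_left (card_Icc_neg_le n hn) _)
    _ = 3 ^ R.card * (n * Real.sqrt n ^ (2 * R.card)) := by
        rw [pow_mul, Real.sq_sqrt (by positivity)]; push_cast; ring
    _ ≤ 3 ^ p * (n * Real.sqrt n ^ (p - 1)) := by
        gcongr
        · norm_num
        · omega
        · omega

/-! ### Phases of paths and averages over labels. -/

/-- Sum over the two-valued labels that are constant on the pairs. -/
theorem sum_labels_prod {p : ℕ} {π : Equiv.Perm (Fin p)} (hπ : π ∈ pairings p) (z : Fin p → ℂ) :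
    ∑ a ∈ Finset.univ.filter (fun a : Fin p → Fin 2 => ∀ s, a (π s) = a s),
      ∏ s, (if a s = 1 then z s else 1) =
    ∏ s : {s : Fin p // s < π s}, (1 + z s.1 * z (π s.1)) := by
  classical
  have h1 : ∀ s : {s : Fin p // s < π s}, 1 + z s.1 * z (π s.1) =
      ∑ j : Fin 2, if j = 1 then z s.1 * z (π s.1) else 1 := by
    intro s; simp [Fin.sum_univ_two]
  rw [Finset.prod_congr rfl fun s _ => h1 s, Finset.prod_univ_sum]
  -- A label constant on pairs is read off at the smaller point of each pair.
  let e : ({s : Fin p // s < π s} → Fin 2) → Fin p → Fin 2 := fun b s =>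
    if h : s < π s then b ⟨s, h⟩ else
      b ⟨π s, by
        rw [(mem_pairings.1 hπ s).1]
        exact lt_of_le_of_ne (not_lt.1 h) (mem_pairings.1 hπ s).2⟩
  refine Finset.sum_nbij' (fun a s => a s.1) e ?_ ?_ ?_ ?_ ?_
  · intro a _; simp
  · intro b _
    simp only [Finset.mem_filter, Finset.mem_univ, true_and, e]
    intro s
    rcases lt_or_gt_of_ne (mem_pairings.1 hπ s).2 with h | h
    · have h' : π s < π (π s) := by rwa [(mem_pairings.1 hπ s).1]
      rw [dif_pos h', dif_neg h.not_gt]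
    · have h' : ¬ π s < π (π s) := by rw [(mem_pairings.1 hπ s).1]; exact h.not_gt
      rw [dif_neg h', dif_pos h]
      congr 1
      exact Subtype.ext (mem_pairings.1 hπ s).1
  · intro a ha
    simp only [Finset.mem_filter, Finset.mem_univ, true_and] at ha
    funext s
    simp only [e]
    split_ifs
    · rfl
    · exact ha s
  · intro b _
    funext s
    simp [e, s.2]
  · intro a ha
    simp only [Finset.mem_filter, Finset.mem_univ, true_and] at ha
    rw [prod_eq_prod_pairs hπ]
    refine Finset.prod_congr rfl fun s _ => ?_
    rw [ha]
    split_ifs <;> simp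

/-- The phase of a path: a factor `exp (i π (x (s + 1) - x s) / n)` for every position `s` that
carries the second label. -/
noncomputable def pathPhase {p n : ℕ} (a : Fin p → Fin 2) (x : Fin (p + 1) → Fin n) : ℂ :=
  ∏ s, if a s = 1 then
    Complex.exp (Complex.I * Real.pi * ((((x s.succ : ℤ) - (x s.castSucc : ℤ) : ℤ) : ℂ) / n))
    else 1

theorem norm_pathPhase {p n : ℕ} (a : Fin p → Fin 2) (x : Fin (p + 1) → Fin n) :
    ‖pathPhase a x‖ = 1 := by
  rw [pathPhase, norm_prod]
  refine Finset.prod_eq_one fun s _ => ?_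
  split_ifs
  · have : (((((x s.succ : ℤ) - (x s.castSucc : ℤ) : ℤ) : ℂ) / n)) =
      (((((x s.succ : ℤ) - (x s.castSucc : ℤ) : ℤ) : ℝ) / n : ℝ) : ℂ) := by push_cast; rfl
    rw [Complex.norm_exp, this]
    simp
  · simp

/-- Averaging the phase over the labels selects the paths whose integer steps match. -/
theorem sum_labels_pathPhase {p n : ℕ} {π : Equiv.Perm (Fin p)} (hπ : π ∈ pairings p)
    (ε : Fin p → Bool) (hε : ∀ s, ε (π s) ≠ ε s) (x : Fin (p + 1) → Fin n)
    (hx : ∀ s, mstep ε x (π s) = mstep ε x s) :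
    ∑ a ∈ Finset.univ.filter (fun a : Fin p → Fin 2 => ∀ s, a (π s) = a s), pathPhase a x =
      if ∀ s, zstep ε x (π s) = zstep ε x s then
        2 ^ Fintype.card {s : Fin p // s < π s} else 0 := by
  have hn : (n : ℂ) ≠ 0 := by
    rcases Nat.eq_zero_or_pos n with rfl | hn
    · exact (x 0).elim0
    · exact_mod_cast hn.ne'
  have h1 : ∀ s, Complex.exp
        (Complex.I * Real.pi * ((((x s.succ : ℤ) - (x s.castSucc : ℤ) : ℤ) : ℂ) / n)) *
      Complex.exp (Complex.I * Real.pi *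
        ((((x (π s).succ : ℤ) - (x (π s).castSucc : ℤ) : ℤ) : ℂ) / n)) =
      if zstep ε x (π s) = zstep ε x s then 1 else -1 := by
    intro s
    rw [← Complex.exp_add, ← mul_add, ← add_div, ← Int.cast_add]
    obtain ⟨c, hc⟩ := (mstep_eq_iff ε x (π s) s).1 (hx s)
    have hs : ∃ δ : ℤ, (δ = 1 ∨ δ = -1) ∧
        ((x s.succ : ℤ) - (x s.castSucc : ℤ)) + ((x (π s).succ : ℤ) - (x (π s).castSucc : ℤ)) =
        δ * (zstep ε x (π s) - zstep ε x s) := by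
      have := hε s
      unfold zstep
      by_cases h2 : ε s = true
      · have h3 : ε (π s) = false := by simpa [h2] using this
        exact ⟨1, Or.inl rfl, by simp [h2, h3]; ring⟩
      · have h3 : ε (π s) = true := by simpa [h2] using this
        exact ⟨-1, Or.inr rfl, by simp [h2, h3]; ring⟩
    obtain ⟨δ, hδ, hs⟩ := hs
    rw [hs]
    split_ifs with h
    · simp [h]
    · have h3 := abs_lt.1 (abs_zstep_lt ε x (π s))
      have h4 := abs_lt.1 (abs_zstep_lt ε x s)
      have hn0 : (0 : ℤ) < n := by omega
      -- The steps differ by nc with |nc| < 2n, so c is 0 or ±1. The product of the two phases is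
      -- exp(±iπc), which is -1 when c ≠ 0.
      have hc1 : c < 2 := by nlinarith
      have hc2 : -2 < c := by nlinarith
      have hc0 : c ≠ 0 := by
        rintro rfl
        apply h
        linarith
      have hδc : δ * c = 1 ∨ δ * c = -1 := by
        have : c = 1 ∨ c = -1 := by omega
        rcases hδ with rfl | rfl <;> rcases this with rfl | rfl <;> simp
      rw [hc]
      have h5 : Complex.I * Real.pi * (((δ * (n * c) : ℤ) : ℂ) / n) =
          ((δ * c : ℤ) : ℂ) * (Real.pi * Complex.I) := by
        push_cast; field_simp
      rw [h5]
      rcases hδc with h6 | h6 <;> rw [h6]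
      · simp [Complex.exp_pi_mul_I]
      · simp [Complex.exp_neg, Complex.exp_pi_mul_I]
  unfold pathPhase
  rw [sum_labels_prod hπ]
  simp only [h1]
  split_ifs with h
  · simp only [h, if_true]
    rw [Finset.prod_const]
    norm_num
  · push Not at h
    obtain ⟨s, hs⟩ := h
    rcases lt_or_gt_of_ne (mem_pairings.1 hπ s).2 with h | h
    · refine Finset.prod_eq_zero (i := ⟨π s, by rwa [(mem_pairings.1 hπ s).1]⟩)
        (Finset.mem_univ _) ?_
      simp only [(mem_pairings.1 hπ s).1]
      rw [if_neg (Ne.symm hs)]; norm_num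
    · refine Finset.prod_eq_zero (i := ⟨s, h⟩) (Finset.mem_univ _) ?_
      simp only
      rw [if_neg hs]; norm_num

/-! ### Riemann sums over the unit cube. -/

theorem iUnion_gridCell_eq {ι : Type*} [Fintype ι] {n : ℕ} (hn : 0 < n) :
    (⋃ y : ι → Fin n, Set.pi Set.univ fun v => Set.Ico ((y v : ℝ) / n) (((y v : ℝ) + 1) / n)) =
      Set.pi Set.univ fun _ : ι => Set.Ico (0 : ℝ) 1 := by
  have hn' : (0 : ℝ) < n := by exact_mod_cast hn
  ext x
  simp only [Set.mem_iUnion, Set.mem_pi, Set.mem_univ, true_implies, Set.mem_Ico]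
  constructor
  · rintro ⟨y, hy⟩ v
    refine ⟨le_trans (by positivity) (hy v).1, (hy v).2.trans_le ?_⟩
    rw [div_le_one hn']
    exact_mod_cast (y v).isLt
  · intro hx
    refine ⟨fun v => ⟨⌊n * x v⌋₊, ?_⟩, fun v => ?_⟩
    · rw [Nat.floor_lt (mul_nonneg hn'.le (hx v).1)]
      nlinarith [(hx v).2]
    · rw [div_le_iff₀ hn', lt_div_iff₀ hn', mul_comm (x v)]
      exact ⟨Nat.floor_le (mul_nonneg hn'.le (hx v).1), Nat.lt_floor_add_one _⟩

/-- The integral of the discretization of `F` on the grid of mesh `1 / n` is a Riemann sum. -/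
theorem setIntegral_comp_floor_eq_sum {ι : Type*} [Fintype ι] [DecidableEq ι] {n : ℕ} (hn : 0 < n)
    (F : (ι → ℝ) → ℂ) :
    ∫ x in Set.Icc (0 : ι → ℝ) 1, F (fun v => (⌊n * x v⌋ : ℝ) / n) =
      ((n : ℂ) ^ Fintype.card ι)⁻¹ * ∑ y : ι → Fin n, F (fun v => (y v : ℝ) / n) := by
  have hn' : (0 : ℝ) < n := by exact_mod_cast hn
  have hfl : ∀ y : ι → Fin n,
      ∀ x ∈ Set.pi Set.univ fun v => Set.Ico ((y v : ℝ) / n) (((y v : ℝ) + 1) / n),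
      F (fun v => (⌊n * x v⌋ : ℝ) / n) = F (fun v => (y v : ℝ) / n) := by
    intro y x hx
    congr 1
    funext v
    have := hx v (Set.mem_univ v)
    rw [Set.mem_Ico, div_le_iff₀ hn', lt_div_iff₀ hn', mul_comm (x v)] at this
    have h2 : ⌊n * x v⌋ = ((y v : ℕ) : ℤ) := Int.floor_eq_iff.2 (by exact_mod_cast this)
    rw [h2, Int.cast_natCast]
  have hmeas : ∀ y : ι → Fin n, MeasurableSet
      (Set.pi Set.univ fun v => Set.Ico ((y v : ℝ) / n) (((y v : ℝ) + 1) / n)) :=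
    fun y => MeasurableSet.univ_pi fun _ => measurableSet_Ico
  have hvol : ∀ y : ι → Fin n, volume.real
      (Set.pi Set.univ fun v => Set.Ico ((y v : ℝ) / n) (((y v : ℝ) + 1) / n)) =
      ((n : ℝ) ^ Fintype.card ι)⁻¹ := by
    intro y
    rw [Measure.real, Real.volume_pi_Ico_toReal fun v => by gcongr; linarith]
    have : ∀ v, ((y v : ℝ) + 1) / n - (y v : ℝ) / n = (n : ℝ)⁻¹ := fun v => by field_simp; ring
    simp [this]
  -- Half-open cells are disjoint but tile the half-open cube, which differs from the closed one by
  -- a null set.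
  have hae : (Set.pi Set.univ fun _ : ι => Set.Ico (0 : ℝ) 1) =ᵐ[volume] Set.Icc (0 : ι → ℝ) 1 :=
    Measure.univ_pi_Ico_ae_eq_Icc (μ := fun _ : ι => (volume : Measure ℝ))
      (f := fun _ => 0) (g := fun _ => 1)
  rw [← setIntegral_congr_set hae, ← iUnion_gridCell_eq hn, integral_iUnion_fintype hmeas]
  · rw [Finset.mul_sum]
    refine Finset.sum_congr rfl fun y _ => ?_
    rw [setIntegral_congr_fun (hmeas y) (hfl y), setIntegral_const, hvol, Complex.real_smul]
    push_cast; rfl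
  · intro y y' hyy
    rw [Function.onFun, Set.disjoint_left]
    intro x hx hx'
    apply hyy
    funext v
    have h1 := hx v (Set.mem_univ v)
    have h2 := hx' v (Set.mem_univ v)
    rw [Set.mem_Ico, div_le_iff₀ hn', lt_div_iff₀ hn'] at h1 h2
    have h3 : (y v : ℝ) < (y' v : ℝ) + 1 := by linarith
    have h4 : (y' v : ℝ) < (y v : ℝ) + 1 := by linarith
    apply Fin.ext
    have h3' : (y v : ℕ) < y' v + 1 := by exact_mod_cast h3
    have h4' : (y' v : ℕ) < y v + 1 := by exact_mod_cast h4
    omega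
  · intro y
    refine (integrableOn_congr_fun (hfl y) (hmeas y)).2 (integrableOn_const ?_)
    rw [Real.volume_pi_Ico]
    exact (ENNReal.prod_lt_top fun _ _ => ENNReal.ofReal_lt_top).ne

theorem tendsto_floor_mul_div (x : ℝ) :
    Tendsto (fun n : ℕ => (⌊n * x⌋ : ℝ) / n) atTop (𝓝 x) := by
  rw [tendsto_iff_norm_sub_tendsto_zero]
  refine squeeze_zero' (Eventually.of_forall fun _ => norm_nonneg _) ?_
    (tendsto_one_div_atTop_nhds_zero_nat (𝕜 := ℝ))
  filter_upwards [eventually_gt_atTop 0] with n hn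
  have hn' : (0 : ℝ) < n := by exact_mod_cast hn
  rw [Real.norm_eq_abs, abs_le]
  have h1 := Int.floor_le (n * x)
  have h2 := Int.lt_floor_add_one (n * x)
  constructor
  · rw [← sub_nonneg]
    have : (⌊n * x⌋ : ℝ) / n - x - -(1 / (n : ℝ)) = (⌊n * x⌋ + 1 - n * x) / n := by
      field_simp; ring
    rw [this]
    exact div_nonneg (by linarith) hn'.le
  · rw [← sub_nonneg]
    have : 1 / (n : ℝ) - ((⌊n * x⌋ : ℝ) / n - x) = (n * x + 1 - ⌊n * x⌋) / n := by
      field_simp; ring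
    rw [this]
    exact div_nonneg (by linarith) hn'.le

/-- Riemann sums over the unit cube of a bounded almost everywhere continuous function. -/
theorem tendsto_gridSum {ι : Type*} [Fintype ι] [DecidableEq ι] (F : (ι → ℝ) → ℂ) {C : ℝ} (hb : ∀ x, ‖F x‖ ≤ C)
    (hc : ∀ᵐ x, ContinuousAt F x) :
    Tendsto (fun n : ℕ => ((n : ℂ) ^ Fintype.card ι)⁻¹ *
      ∑ y : ι → Fin n, F (fun v => (y v : ℝ) / n)) atTop
      (𝓝 (∫ x in Set.Icc (0 : ι → ℝ) 1, F x)) := by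
  have hfin : volume (Set.Icc (0 : ι → ℝ) 1) ≠ ⊤ := isCompact_Icc.measure_lt_top.ne
  have hlim : Tendsto (fun n : ℕ =>
      ∫ x in Set.Icc (0 : ι → ℝ) 1, F (fun v => (⌊n * x v⌋ : ℝ) / n)) atTop
      (𝓝 (∫ x in Set.Icc (0 : ι → ℝ) 1, F x)) := by
    refine tendsto_integral_of_dominated_convergence (fun _ => C) (fun n => ?_)
      (integrableOn_const hfin) (fun n => ae_of_all _ fun x => hb _) ?_
    -- Measurability of `F` is not needed: the discretization factors through the countable type `ι
    -- → ℤ`.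
    · have h1 : Measurable fun (x : ι → ℝ) (v : ι) => ⌊n * x v⌋ :=
        measurable_pi_lambda _ fun v =>
          Int.measurable_floor.comp ((measurable_pi_apply v).const_mul _)
      have h2 : Measurable fun z : ι → ℤ => F (fun v => (z v : ℝ) / n) := measurable_of_countable _
      exact (h2.comp h1).aestronglyMeasurable
    · refine ae_restrict_of_ae ?_
      filter_upwards [hc] with x hx
      exact hx.tendsto.comp (tendsto_pi_nhds.2 fun v => tendsto_floor_mul_div (x v))
  refine hlim.congr' ?_
  filter_upwards [eventually_gt_atTop 0] with n hn
  exact setIntegral_comp_floor_eq_sum hn F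

/-- A nonzero linear functional pushes Lebesgue measure to a multiple of Lebesgue measure, so its
level sets are null. Thus the discontinuities of the fractional parts are negligible. -/
theorem ae_sum_mul_notMem_int {ι : Type*} [Fintype ι] (l : ι → ℤ) (hl : ∃ v, l v ≠ 0) :
    ∀ᵐ x : ι → ℝ, ∀ m : ℤ, ∑ v, (l v : ℝ) * x v ≠ m := by
  classical
  rw [ae_all_iff]
  intro m
  obtain ⟨v, hv⟩ := hl
  let L : (ι → ℝ) →ₗ[ℝ] ℝ := ∑ v, (l v : ℝ) • LinearMap.proj v
  have hL : ∀ x, L x = ∑ v, (l v : ℝ) * x v := fun x => by simp [L]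
  have hv' : (l v : ℝ) ≠ 0 := by exact_mod_cast hv
  have hsurj : Function.Surjective L := by
    intro c
    refine ⟨Pi.single v (c / l v), ?_⟩
    rw [hL, Finset.sum_eq_single v]
    · simp; field_simp
    · intro w _ hw; simp [hw]
    · simp
  obtain ⟨c, -, hc⟩ := L.exists_map_addHaar_eq_smul_addHaar volume volume hsurj
  have hLm : Measurable L := L.continuous_of_finiteDimensional.measurable
  have h0 : volume (L ⁻¹' {(m : ℝ)}) = 0 := by
    rw [← Measure.map_apply hLm (measurableSet_singleton _), hc]
    simp
  rw [ae_iff]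
  convert h0 using 2
  ext x
  simp [hL]

/-- The integrand of `fractExpIntegral`. -/
noncomputable def fractExp (θ : ℝ) {ι J : Type*} [Fintype ι] [Fintype J] (k : J → ℤ)
    (l : J → ι → ℤ) (x : ι → ℝ) : ℂ :=
  Complex.exp (Complex.I * θ * ((∑ r, (k r : ℝ) * Int.fract (∑ v, (l r v : ℝ) * x v) : ℝ) : ℂ))

theorem norm_fractExp (θ : ℝ) {ι J : Type*} [Fintype ι] [Fintype J] (k : J → ℤ)
    (l : J → ι → ℤ) (x : ι → ℝ) : ‖fractExp θ k l x‖ = 1 := by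
  rw [fractExp, mul_assoc, mul_comm, ← Complex.ofReal_mul, Complex.norm_exp_ofReal_mul_I]

theorem continuousAt_fractExp (θ : ℝ) {ι J : Type*} [Fintype ι] [Fintype J] (k : J → ℤ)
    (l : J → ι → ℤ) (x : ι → ℝ) (hx : ∀ r, ∀ m : ℤ, ∑ v, (l r v : ℝ) * x v ≠ m) :
    ContinuousAt (fractExp θ k l) x := by
  refine Complex.continuous_exp.continuousAt.comp (ContinuousAt.mul continuousAt_const
    (Complex.continuous_ofReal.continuousAt.comp ?_))
  refine tendsto_finsetSum _ fun r _ => ContinuousAt.mul continuousAt_const ?_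
  have h1 : ContinuousAt (fun x : ι → ℝ => ∑ v, (l r v : ℝ) * x v) x :=
    tendsto_finsetSum _ fun v _ => continuousAt_const.mul (continuous_apply v).continuousAt
  exact ContinuousAt.comp (f := fun x : ι → ℝ => ∑ v, (l r v : ℝ) * x v)
    (continuousAt_fract (hx r _)) h1

theorem tendsto_gridSum_fractExp (θ : ℝ) {ι J : Type*} [Fintype ι] [DecidableEq ι] [Fintype J] (k : J → ℤ)
    (l : J → ι → ℤ) (hl : ∀ r, ∃ v, l r v ≠ 0) :
    Tendsto (fun n : ℕ => ((n : ℂ) ^ Fintype.card ι)⁻¹ *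
      ∑ y : ι → Fin n, fractExp θ k l (fun v => (y v : ℝ) / n)) atTop
      (𝓝 (fractExpIntegral θ k l)) := by
  refine tendsto_gridSum _ (fun x => (norm_fractExp θ k l x).le) ?_
  have := ae_all_iff.2 fun r => ae_sum_mul_notMem_int (l r) (hl r)
  filter_upwards [this] with x hx
  exact continuousAt_fractExp θ k l x hx

theorem norm_fractExpIntegral_le (θ : ℝ) {ι J : Type*} [Fintype ι] [Fintype J] (k : J → ℤ)
    (l : J → ι → ℤ) : ‖fractExpIntegral θ k l‖ ≤ 1 := by
  have h := norm_setIntegral_le_of_norm_le_const (μ := volume) (s := Set.Icc (0 : ι → ℝ) 1)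
    (f := fractExp θ k l) (C := 1) isCompact_Icc.measure_lt_top
    (fun x _ => (norm_fractExp θ k l x).le)
  have hv : volume.real (Set.Icc (0 : ι → ℝ) 1) = 1 := by
    rw [Measure.real, Real.volume_Icc_pi_toReal zero_le_one]; simp
  rw [hv, mul_one] at h
  exact h

/-! ### Grid parametrization of the paths matched modulo n. -/

/-- The integer coefficients of the phase of a word with labels `a`. -/
def labelCoeff {p : ℕ} (a : Fin p → Fin 2) (r : Fin (p + 1)) : ℤ :=
  ∑ s : Fin p, if a s = 1 then (if r = s.succ then 1 else 0) - (if r = s.castSucc then 1 else 0)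
    else 0

/-- Summation by parts: the phases of the steps are regrouped by the vertices of the path. -/
theorem pathPhase_eq_exp {p n : ℕ} (a : Fin p → Fin 2) (x : Fin (p + 1) → Fin n) :
    pathPhase a x = Complex.exp (Complex.I * Real.pi *
      ((∑ r, (labelCoeff a r : ℝ) * ((x r : ℝ) / n) : ℝ) : ℂ)) := by
  have h : ∑ r, (labelCoeff a r : ℝ) * ((x r : ℝ) / n) =
      ∑ s, if a s = 1 then ((x s.succ : ℝ) - (x s.castSucc : ℝ)) / n else 0 := by
    simp only [labelCoeff, Int.cast_sum, Finset.sum_mul]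
    rw [Finset.sum_comm]
    refine Finset.sum_congr rfl fun s _ => ?_
    split_ifs with h
    · simp only [Int.cast_sub, Int.cast_ite, Int.cast_one, Int.cast_zero, sub_mul, ite_mul, one_mul,
        zero_mul, Finset.sum_sub_distrib, Finset.sum_ite_eq', Finset.mem_univ, if_true, sub_div]
    · simp
  rw [h, pathPhase, Complex.ofReal_sum, Finset.mul_sum, Complex.exp_sum]
  refine Finset.prod_congr rfl fun s _ => ?_
  split_ifs <;> simp

/-- The integer path of the grid point `y` along the forms of a pair partition. -/
def formPath {p n : ℕ} (π : Equiv.Perm (Fin p)) (y : Option {s : Fin p // s < π s} → Fin n)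
    (r : Fin (p + 1)) : ℤ :=
  ∑ v, pairingForm π r v * (y v : ℤ)

theorem formPath_eq {p n : ℕ} (π : Equiv.Perm (Fin p))
    (y : Option {s : Fin p // s < π s} → Fin n) (r : Fin (p + 1)) :
    formPath π y r = (y none : ℤ) + ∑ u : {s : Fin p // s < π s},
      ((if u.1.castSucc < r then 1 else 0) - (if (π u.1).castSucc < r then 1 else 0)) *
        (y (some u) : ℤ) := by
  rw [formPath, Fintype.sum_option]
  simp [pairingForm]

theorem formPath_zero {p n : ℕ} (π : Equiv.Perm (Fin p))
    (y : Option {s : Fin p // s < π s} → Fin n) : formPath π y 0 = y none := by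
  simp [formPath_eq]

theorem formPath_last {p n : ℕ} (π : Equiv.Perm (Fin p))
    (y : Option {s : Fin p // s < π s} → Fin n) : formPath π y (Fin.last p) = y none := by
  simp [formPath_eq, Fin.castSucc_lt_last]

/-- The indicator of t < r jumps exactly between r = t and r = t + 1, so the coordinate of a pair is
added at its smaller point and subtracted at its larger one. -/
theorem formPath_succ_sub {p n : ℕ} (π : Equiv.Perm (Fin p))
    (y : Option {s : Fin p // s < π s} → Fin n) (s : Fin p) :
    formPath π y s.succ - formPath π y s.castSucc = ∑ u : {s : Fin p // s < π s},
      ((if u.1 = s then 1 else 0) - (if π u.1 = s then 1 else 0)) * (y (some u) : ℤ) := by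
  have key : ∀ t : Fin p, (if t.castSucc < s.succ then (1 : ℤ) else 0) =
      (if t.castSucc < s.castSucc then 1 else 0) + if t = s then 1 else 0 := by
    intro t
    simp only [Fin.castSucc_lt_succ_iff, Fin.castSucc_lt_castSucc_iff]
    rcases lt_trichotomy t s with h | h | h
    · simp [h, h.le, h.ne]
    · simp [h]
    · simp [h.not_ge, h.not_gt, h.ne']
  rw [formPath_eq, formPath_eq, add_sub_add_left_eq_sub, ← Finset.sum_sub_distrib]
  refine Finset.sum_congr rfl fun u _ => ?_
  rw [key, key]
  ring

theorem formPath_succ_sub_left {p n : ℕ} {π : Equiv.Perm (Fin p)} (hπ : π ∈ pairings p)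
    (y : Option {s : Fin p // s < π s} → Fin n) (s : {s : Fin p // s < π s}) :
    formPath π y s.1.succ - formPath π y s.1.castSucc = y (some s) := by
  rw [formPath_succ_sub, Finset.sum_eq_single s]
  · simp [(mem_pairings.1 hπ s.1).2]
  · intro u _ hu
    have h1 : u.1 ≠ s.1 := fun h => hu (Subtype.ext h)
    have h2 : π u.1 ≠ s.1 := by
      intro h
      have h3 := s.2
      rw [← h, (mem_pairings.1 hπ u.1).1] at h3
      exact h3.not_gt u.2
    simp [h1, h2]
  · simp

theorem formPath_succ_sub_right {p n : ℕ} {π : Equiv.Perm (Fin p)} (hπ : π ∈ pairings p)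
    (y : Option {s : Fin p // s < π s} → Fin n) (s : {s : Fin p // s < π s}) :
    formPath π y (π s.1).succ - formPath π y (π s.1).castSucc = -(y (some s) : ℤ) := by
  rw [formPath_succ_sub, Finset.sum_eq_single s]
  · simp [(mem_pairings.1 hπ s.1).2.symm]
  · intro u _ hu
    have h1 : u.1 ≠ s.1 := fun h => hu (Subtype.ext h)
    have h2 : u.1 ≠ π s.1 := by
      intro h
      have h3 := u.2
      rw [h, (mem_pairings.1 hπ s.1).1] at h3
      exact h3.not_gt s.2
    simp [h1, h2]
  · simp

/-- The path modulo `n` of a grid point. -/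
def gridPath {p n : ℕ} (π : Equiv.Perm (Fin p)) (y : Option {s : Fin p // s < π s} → Fin n)
    (r : Fin (p + 1)) : Fin n :=
  ⟨(formPath π y r % n).toNat, by
    have := (y none).pos
    have h1 := Int.emod_lt_of_pos (formPath π y r) (Int.natCast_pos.2 this)
    omega⟩

theorem intCast_gridPath {p n : ℕ} (π : Equiv.Perm (Fin p))
    (y : Option {s : Fin p // s < π s} → Fin n) (r : Fin (p + 1)) :
    ((gridPath π y r : ℕ) : ℤ) = formPath π y r % n := by
  have := (y none).pos
  have h1 := Int.emod_nonneg (formPath π y r) (b := n) (by omega)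
  simp only [gridPath]
  omega

theorem gridPath_modEq {p n : ℕ} (π : Equiv.Perm (Fin p))
    (y : Option {s : Fin p // s < π s} → Fin n) (r : Fin (p + 1)) :
    ((gridPath π y r : ℕ) : ℤ) ≡ formPath π y r [ZMOD n] := by
  rw [intCast_gridPath]
  exact Int.mod_modEq _ _

theorem Fin.eq_of_intCast_modEq {n : ℕ} {i j : Fin n} (h : (i : ℤ) ≡ (j : ℤ) [ZMOD n]) :
    i = j := by
  have h1 := i.isLt
  have h2 := j.isLt
  have h3 := Int.eq_zero_of_abs_lt_dvd h.dvd (by rw [abs_lt]; constructor <;> omega)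
  apply Fin.ext
  omega

theorem Fin.intCast_sub_modEq {n : ℕ} (i j : Fin n) :
    ((i - j : Fin n) : ℤ) ≡ (i : ℤ) - j [ZMOD n] := by
  rw [Fin.intCast_val_sub_eq_sub_add_ite]
  split_ifs <;> simp [Int.ModEq]

/-- With opposite signs, agreement of the signed steps means that the raw steps are opposite modulo
n. -/
theorem mstep_pairing_iff {p n : ℕ} {π : Equiv.Perm (Fin p)} {ε : Fin p → Bool}
    (hε : ∀ s, ε (π s) ≠ ε s) (x : Fin (p + 1) → Fin n) (s : Fin p) :
    mstep ε x (π s) = mstep ε x s ↔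
      ((x (π s).succ : ℤ) - (x (π s).castSucc : ℤ)) ≡
        -((x s.succ : ℤ) - (x s.castSucc : ℤ)) [ZMOD n] := by
  rw [mstep_eq_iff, Int.modEq_iff_dvd]
  have := hε s
  unfold zstep
  by_cases h2 : ε s = true
  · have h3 : ε (π s) = false := by simpa [h2] using this
    rw [← dvd_neg]
    simp [h2, h3]
  · have h3 : ε (π s) = true := by simpa [h2] using this
    simp [h2, h3]
    ring_nf

/-- The closed paths modulo `n` that match along a pair partition are parametrized by a grid. -/
theorem sum_matched_closedPaths {p n : ℕ} {π : Equiv.Perm (Fin p)} (hπ : π ∈ pairings p)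
    {ε : Fin p → Bool} (hε : ∀ s, ε (π s) ≠ ε s) (f : (Fin (p + 1) → Fin n) → ℂ) :
    ∑ x ∈ (closedPaths p n).filter (fun x => ∀ s, mstep ε x (π s) = mstep ε x s), f x =
      ∑ y : Option {s : Fin p // s < π s} → Fin n, f (gridPath π y) := by
  symm
  -- The inverse keeps the starting vertex and, for each pair, the step modulo n at its smaller
  -- point.
  let back : (Fin (p + 1) → Fin n) → Option {s : Fin p // s < π s} → Fin n := fun x v =>
    v.elim (x 0) fun s => x s.1.succ - x s.1.castSucc
  have hsub : ∀ (y : Option {s : Fin p // s < π s} → Fin n) (s : Fin p),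
      ((gridPath π y s.succ : ℕ) : ℤ) - ((gridPath π y s.castSucc : ℕ) : ℤ) ≡
        formPath π y s.succ - formPath π y s.castSucc [ZMOD n] :=
    fun y s => (gridPath_modEq π y _).sub (gridPath_modEq π y _)
  refine Finset.sum_nbij' (gridPath π) back ?_ ?_ ?_ ?_ fun _ _ => rfl
  · intro y _
    simp only [Finset.mem_filter, mem_closedPaths]
    refine ⟨Fin.ext ?_, fun s => ?_⟩
    · simp only [gridPath, formPath_zero, formPath_last]
    · rw [mstep_pairing_iff hε]
      refine (hsub y _).trans (Int.ModEq.trans ?_ (hsub y s).neg.symm)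
      rcases lt_or_gt_of_ne (mem_pairings.1 hπ s).2 with h | h
      · have h1 := formPath_succ_sub_left hπ y ⟨π s, by rwa [(mem_pairings.1 hπ s).1]⟩
        have h2 := formPath_succ_sub_right hπ y ⟨π s, by rwa [(mem_pairings.1 hπ s).1]⟩
        simp only [(mem_pairings.1 hπ s).1] at h1 h2
        rw [h1, h2, neg_neg]
      · rw [formPath_succ_sub_left hπ y ⟨s, h⟩, formPath_succ_sub_right hπ y ⟨s, h⟩]
  · intro x _; simp
  · intro y _
    funext v
    apply Fin.eq_of_intCast_modEq
    cases v with
    | none =>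
      simp only [back, Option.elim_none]
      rw [← formPath_zero π y]
      exact gridPath_modEq π y 0
    | some s =>
      simp only [back, Option.elim_some]
      rw [← formPath_succ_sub_left hπ y s]
      exact (Fin.intCast_sub_modEq _ _).trans (hsub y s.1)
  · intro x hx
    simp only [Finset.mem_filter, mem_closedPaths] at hx
    have hcase : ∀ s : Fin p, formPath π (back x) s.succ - formPath π (back x) s.castSucc ≡
        (x s.succ : ℤ) - (x s.castSucc : ℤ) [ZMOD n] := by
      intro s
      rcases lt_or_gt_of_ne (mem_pairings.1 hπ s).2 with h | h
      · have h2 := formPath_succ_sub_right hπ (back x)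
          ⟨π s, by rwa [(mem_pairings.1 hπ s).1]⟩
        simp only [(mem_pairings.1 hπ s).1] at h2
        rw [h2]
        simp only [back, Option.elim_some]
        have h3 := (mstep_pairing_iff hε x s).1 (hx.2 s)
        refine (Fin.intCast_sub_modEq _ _).neg.trans (h3.neg.trans ?_)
        rw [neg_neg]
      · rw [formPath_succ_sub_left hπ (back x) ⟨s, h⟩]
        exact Fin.intCast_sub_modEq _ _
    refine path_ext_of_mstep (ε := fun _ => false) ?_ fun s => ?_
    · apply Fin.eq_of_intCast_modEq
      refine (gridPath_modEq π _ 0).trans ?_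
      rw [formPath_zero]
      rfl
    · simp only [mstep, Bool.false_eq_true, if_false]
      apply Fin.eq_of_intCast_modEq
      exact (Fin.intCast_sub_modEq _ _).trans (((hsub _ s).trans (hcase s)).trans
        (Fin.intCast_sub_modEq _ _).symm)

/-- Dividing by n turns the residue of the integer path into the fractional part of the linear form
at the grid point y/n. -/
theorem pathPhase_gridPath {p n : ℕ} (π : Equiv.Perm (Fin p)) (a : Fin p → Fin 2)
    (y : Option {s : Fin p // s < π s} → Fin n) :
    pathPhase a (gridPath π y) =
      fractExp Real.pi (labelCoeff a) (pairingForm π) fun v => (y v : ℝ) / n := by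
  rw [pathPhase_eq_exp, fractExp]
  congr 3
  refine Finset.sum_congr rfl fun r _ => ?_
  congr 1
  have h1 : ∑ v, (pairingForm π r v : ℝ) * ((y v : ℝ) / n) = (formPath π y r : ℝ) / n := by
    rw [formPath]
    push_cast
    rw [Finset.sum_div]
    exact Finset.sum_congr rfl fun v _ => by ring
  rw [h1, Int.fract_div_intCast_eq_div_intCast_mod, ← intCast_gridPath]
  simp

/-- The normalized sum of the phases over the matched paths converges to an integral. -/
theorem tendsto_sum_matched_pathPhase {p : ℕ} {π : Equiv.Perm (Fin p)} (hπ : π ∈ pairings p)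
    {ε : Fin p → Bool} (hε : ∀ s, ε (π s) ≠ ε s) (a : Fin p → Fin 2) :
    Tendsto (fun n : ℕ => (n : ℂ)⁻¹ * ((Real.sqrt n : ℝ) : ℂ)⁻¹ ^ p *
      ∑ x ∈ (closedPaths p n).filter (fun x => ∀ s, mstep ε x (π s) = mstep ε x s),
        pathPhase a x) atTop
      (𝓝 (fractExpIntegral Real.pi (labelCoeff a) (pairingForm π))) := by
  have h := tendsto_gridSum_fractExp Real.pi (labelCoeff a) (pairingForm π)
    fun r => ⟨none, by simp [pairingForm]⟩
  refine h.congr fun n => ?_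
  rw [sum_matched_closedPaths hπ hε]
  congr 1
  -- The normalization n⁻¹ √n⁻ᵖ is n to the power -(p/2 + 1), one factor per coordinate of the cube.
  · have h2 := two_mul_card_pairs hπ
    have hs : ((Real.sqrt n : ℝ) : ℂ) ^ p = (n : ℂ) ^ Fintype.card {s : Fin p // s < π s} := by
      conv_lhs => rw [← h2]
      rw [pow_mul, ← Complex.ofReal_pow, Real.sq_sqrt (by positivity), Complex.ofReal_natCast]
    rw [Fintype.card_option, inv_pow, hs, pow_succ, mul_inv, mul_comm]
  · exact Finset.sum_congr rfl fun y _ => (pathPhase_gridPath π a y).symm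

/-! ### Traces of words as sums over closed paths. -/

theorem prod_ofFn_apply {ι : Type*} [Fintype ι] [DecidableEq ι] :
    ∀ (p : ℕ) (M : Fin p → Matrix ι ι ℂ) (i j : ι), (List.ofFn M).prod i j =
      ∑ x : Fin (p + 1) → ι, if x 0 = i ∧ x (Fin.last p) = j then
        ∏ s, M s (x s.castSucc) (x s.succ) else 0
  | 0, M, i, j => by
    rw [← (Equiv.funUnique (Fin 1) ι).symm.sum_comp]
    simp [Matrix.one_apply, ite_and]
  | p + 1, M, i, j => by
    rw [List.ofFn_succ, List.prod_cons, Matrix.mul_apply,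
      ← (Fin.consEquiv fun _ => ι).sum_comp, Fintype.sum_prod_type]
    simp only [prod_ofFn_apply p, Finset.mul_sum, Fin.consEquiv_apply, Fin.cons_zero]
    rw [Finset.sum_comm, Finset.sum_comm (s := Finset.univ) (t := Finset.univ)
      (f := fun i' (x : Fin (p + 1) → ι) => _)]
    refine Finset.sum_congr rfl fun x _ => ?_
    rw [Finset.sum_eq_single (x 0) (fun k _ hk => by simp [hk.symm]) (by simp),
      Finset.sum_eq_single i (fun k _ hk => by simp [hk]) (by simp)]
    rw [← Fin.succ_last, Fin.cons_succ, Fin.prod_univ_succ]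
    simp

theorem trace_prod_ofFn {p n : ℕ} (M : Fin p → Matrix (Fin n) (Fin n) ℂ) :
    (List.ofFn M).prod.trace =
      ∑ x ∈ closedPaths p n, ∏ s, M s (x s.castSucc) (x s.succ) := by
  simp only [Matrix.trace, Matrix.diag, prod_ofFn_apply]
  rw [Finset.sum_comm, closedPaths, Finset.sum_filter]
  refine Finset.sum_congr rfl fun x _ => ?_
  rw [Finset.sum_eq_single (x 0) (fun k _ hk => by simp [hk.symm]) (by simp)]
  simp [eq_comm]

theorem trace_evalWord {ι : Type*} {n : ℕ} (B : ι → Matrix (Fin n) (Fin n) ℂ)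
    (w : List (ι × Bool)) :
    (evalWord B w).trace = ∑ x ∈ closedPaths w.length n, ∏ s,
      (if (w.get s).2 then star (B (w.get s).1) else B (w.get s).1) (x s.castSucc) (x s.succ) := by
  rw [← trace_prod_ofFn, evalWord]
  congr 2
  conv_lhs => rw [← List.ofFn_get w, List.map_ofFn]
  rfl

theorem map_evalWord {ι A B : Type*} [Ring A] [StarRing A] [Ring B] [StarRing B] (f : A → B)
    (h1 : f 1 = 1) (hm : ∀ x y, f (x * y) = f x * f y) (hs : ∀ x, f (star x) = star (f x))
    (a : ι → A) (w : List (ι × Bool)) : f (evalWord a w) = evalWord (fun i => f (a i)) w := by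
  induction w with
  | nil => simpa [evalWord] using h1
  | cons l w ih =>
    simp only [evalWord, List.map_cons, List.prod_cons] at ih ⊢
    rw [hm, ih]
    split_ifs <;> simp [hs]

/-! ### Reduction to pair partitions. -/

/-- A sum over paths bounded by the number of paths of one degree of freedom less than the
maximum is negligible. -/
theorem tendsto_normalized_zero {p : ℕ} (u : ℕ → ℝ) (hu : ∀ n, 0 ≤ u n) {C : ℝ}
    (hC : ∀ n : ℕ, u n ≤ C * (n * Real.sqrt n ^ (p - 1))) (h0 : p = 0 → ∀ n, u n = 0) :
    Tendsto (fun n : ℕ => (n : ℝ)⁻¹ * (Real.sqrt n)⁻¹ ^ p * u n) atTop (𝓝 0) := by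
  -- For p = 0 the truncated exponent `p - 1` gains nothing, so this case relies on `h0`.
  rcases Nat.eq_zero_or_pos p with hp | hp
  · simp [h0 hp]
  have hlim : Tendsto (fun n : ℕ => C * (Real.sqrt n)⁻¹) atTop (𝓝 0) := by
    have := (tendsto_inv_atTop_zero.comp
      (Real.tendsto_sqrt_atTop.comp tendsto_natCast_atTop_atTop)).const_mul C
    simpa using this
  refine squeeze_zero' (Eventually.of_forall fun n => ?_) ?_ hlim
  · have := hu n; positivity
  · filter_upwards [eventually_gt_atTop 0] with n hn
    have hn' : (0 : ℝ) < n := by exact_mod_cast hn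
    have hs : 0 < Real.sqrt n := Real.sqrt_pos.2 hn'
    calc (n : ℝ)⁻¹ * (Real.sqrt n)⁻¹ ^ p * u n
        ≤ (n : ℝ)⁻¹ * (Real.sqrt n)⁻¹ ^ p * (C * (n * Real.sqrt n ^ (p - 1))) := by
          gcongr; exact hC n
      _ = C * (Real.sqrt n)⁻¹ := by
          obtain ⟨q, rfl⟩ : ∃ q, p = q + 1 := ⟨p - 1, by omega⟩
          simp only [Nat.add_sub_cancel, inv_pow, pow_succ]
          field_simp

/-- The paths whose data `D` take few values are negligible. -/
theorem tendsto_card_few_values {p : ℕ} {V : ℕ → Type*} [∀ n, DecidableEq (V n)]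
    (D : ∀ n, (Fin (p + 1) → Fin n) → Fin p → V n) (W : ∀ n, Finset (V n))
    (hW : ∀ n x s, D n x s ∈ W n) (hWc : ∀ n, 0 < n → (W n).card ≤ 3 * n)
    (hinj : ∀ n x y, x 0 = y 0 → (∀ s, D n x s = D n y s) → x = y) :
    Tendsto (fun n : ℕ => (n : ℝ)⁻¹ * (Real.sqrt n)⁻¹ ^ p *
      (((closedPaths p n).filter fun x =>
        2 * (Finset.univ.image (D n x)).card < p).card : ℝ)) atTop (𝓝 0) := by
  refine tendsto_normalized_zero (C := (p ^ p * 3 ^ p : ℕ)) _ (fun n => Nat.cast_nonneg _)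
    (fun n => ?_) ?_
  · rcases Nat.eq_zero_or_pos n with rfl | hn
    · rw [Finset.card_eq_zero.2 (Finset.eq_empty_of_forall_notMem fun x _ => (x 0).elim0)]
      simp
    · exact card_few_values_le _ (fun x => x 0) (D n) (W n) (fun x _ => hW n x)
        (fun x _ y _ => hinj n x y) (hWc n hn)
  · rintro rfl n
    simp

/-- If every path contributes the number of its compatible pair partitions, up to an error on the
paths with few values, then the sums over paths are those of the pair partitions. -/
theorem tendsto_sum_paths_sub {p : ℕ} {V : ℕ → Type*} [∀ n, DecidableEq (V n)]
    (D : ∀ n, (Fin (p + 1) → Fin n) → Fin p → V n) (W : ∀ n, Finset (V n))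
    (hW : ∀ n x s, D n x s ∈ W n) (hWc : ∀ n, 0 < n → (W n).card ≤ 3 * n)
    (hinj : ∀ n x y, x 0 = y 0 → (∀ s, D n x s = D n y s) → x = y)
    (c : Fin p → Fin p → Prop) [∀ s t, Decidable (c s t)] {C : ℝ}
    (E f : ∀ n, (Fin (p + 1) → Fin n) → ℂ) (hf : ∀ n x, ‖f n x‖ ≤ 1)
    (hE : ∀ n x, ‖E n x - (((pairings p).filter fun π =>
        (∀ s, D n x (π s) = D n x s) ∧ ∀ s, c s (π s)).card : ℂ)‖ ≤
      if 2 * (Finset.univ.image (D n x)).card < p then C else 0) :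
    Tendsto (fun n : ℕ => (n : ℂ)⁻¹ * ((Real.sqrt n : ℝ) : ℂ)⁻¹ ^ p *
        ∑ x ∈ closedPaths p n, f n x * E n x -
      ∑ π ∈ (pairings p).filter (fun π => ∀ s, c s (π s)),
        (n : ℂ)⁻¹ * ((Real.sqrt n : ℝ) : ℂ)⁻¹ ^ p *
          ∑ x ∈ (closedPaths p n).filter (fun x => ∀ s, D n x (π s) = D n x s), f n x)
      atTop (𝓝 0) := by
  have hfew := (tendsto_card_few_values D W hW hWc hinj).const_mul C
  rw [mul_zero] at hfew
  refine squeeze_zero_norm (fun n => ?_) hfew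
  -- Double counting of the pairs (path, compatible pair partition).
  have h1 : ∑ π ∈ (pairings p).filter (fun π => ∀ s, c s (π s)),
      (n : ℂ)⁻¹ * ((Real.sqrt n : ℝ) : ℂ)⁻¹ ^ p *
        ∑ x ∈ (closedPaths p n).filter (fun x => ∀ s, D n x (π s) = D n x s), f n x =
      (n : ℂ)⁻¹ * ((Real.sqrt n : ℝ) : ℂ)⁻¹ ^ p * ∑ x ∈ closedPaths p n, f n x *
        (((pairings p).filter fun π =>
          (∀ s, D n x (π s) = D n x s) ∧ ∀ s, c s (π s)).card : ℂ) := by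
    rw [← Finset.mul_sum]
    congr 1
    simp only [Finset.sum_filter, Finset.card_filter, Nat.cast_sum, Finset.mul_sum]
    conv_rhs => rw [Finset.sum_comm]
    refine Finset.sum_congr rfl fun π _ => ?_
    by_cases h2 : ∀ s, c s (π s)
    · rw [if_pos h2]
      refine Finset.sum_congr rfl fun x _ => ?_
      by_cases h3 : ∀ s, D n x (π s) = D n x s <;> simp [h2, h3]
    · simp [h2]
  rw [h1, ← mul_sub, ← Finset.sum_sub_distrib]
  simp only [← mul_sub]
  rw [norm_mul]
  have h2 : ‖(n : ℂ)⁻¹ * ((Real.sqrt n : ℝ) : ℂ)⁻¹ ^ p‖ = (n : ℝ)⁻¹ * (Real.sqrt n)⁻¹ ^ p := by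
    simp [abs_of_nonneg (Real.sqrt_nonneg _)]
  rw [h2]
  have h3 : ‖∑ x ∈ closedPaths p n, f n x * (E n x - (((pairings p).filter fun π =>
      (∀ s, D n x (π s) = D n x s) ∧ ∀ s, c s (π s)).card : ℂ))‖ ≤
      C * (((closedPaths p n).filter fun x =>
        2 * (Finset.univ.image (D n x)).card < p).card : ℝ) := by
    refine (norm_sum_le_of_le (f := fun x => f n x * (E n x - _)) _ fun x _ =>
      (norm_mul_le _ _).trans (le_trans
        (mul_le_of_le_one_left (norm_nonneg _) (hf n x)) (hE n x))).trans_eq ?_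
    rw [← Finset.sum_filter, Finset.sum_const, nsmul_eq_mul, mul_comm]
  calc _ ≤ (n : ℝ)⁻¹ * (Real.sqrt n)⁻¹ ^ p * (C * _) := by gcongr
    _ = _ := by ring

/-! ### The circulant and skew-circulant model. -/

/-- The `*`-moment of the labels `a` and the exponents `ε` as a sum over pair partitions. -/
noncomputable def limitMoment {p : ℕ} (a : Fin p → Fin 2) (ε : Fin p → Bool) : ℂ :=
  ∑ π ∈ (pairings p).filter (fun π => ∀ s, a (π s) = a s ∧ ε (π s) ≠ ε s),
    fractExpIntegral Real.pi (labelCoeff a) (pairingForm π)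

/-- The sample space of two independent families of uniform fourth roots of unity. -/
abbrev ModelSpace (n : ℕ) : Type := Fin 2 × Fin n → Fin 4

/-- A fourth root of unity or its conjugate. -/
noncomputable def rootPow (e : Bool) (q : Fin 4) : ℂ :=
  if e then starRingEnd ℂ (Complex.I ^ (q : ℕ)) else Complex.I ^ (q : ℕ)

/-- The moments of a uniform fourth root of unity. -/
noncomputable def rootMoment {p : ℕ} (ε : Fin p → Bool) (S : Finset (Fin p)) : ℂ :=
  4⁻¹ * ∑ q : Fin 4, ∏ s ∈ S, rootPow (ε s) q

theorem norm_rootPow (e : Bool) (q : Fin 4) : ‖rootPow e q‖ = 1 := by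
  unfold rootPow
  split_ifs <;> simp

theorem norm_rootMoment_le {p : ℕ} (ε : Fin p → Bool) (S : Finset (Fin p)) :
    ‖rootMoment ε S‖ ≤ 1 := by
  rw [rootMoment, norm_mul]
  have h : ‖∑ q : Fin 4, ∏ s ∈ S, rootPow (ε s) q‖ ≤ ∑ q : Fin 4, (1 : ℝ) :=
    norm_sum_le_of_le _ fun q _ => by simp [norm_prod, norm_rootPow]
  simp only [Finset.sum_const, Finset.card_univ, Fintype.card_fin, nsmul_eq_mul, mul_one] at h
  have h4 : ‖(4 : ℂ)⁻¹‖ = 4⁻¹ := by simp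
  rw [h4]
  push_cast at h
  linarith

theorem rootMoment_singleton {p : ℕ} (ε : Fin p → Bool) (s : Fin p) : rootMoment ε {s} = 0 := by
  rw [rootMoment]
  simp only [Finset.prod_singleton, Fin.sum_univ_four, rootPow]
  cases ε s <;> simp [pow_succ]

/-- The squares of the fourth roots of unity sum to 0, while ξ times its conjugate is 1. So only
pairs of opposite exponents count, as for a complex Gaussian entry. -/
theorem rootMoment_pair {p : ℕ} (ε : Fin p → Bool) (s t : Fin p) (hst : s ≠ t) :
    rootMoment ε {s, t} = if ε t ≠ ε s then 1 else 0 := by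
  rw [rootMoment]
  simp only [Finset.prod_pair hst, Fin.sum_univ_four, rootPow]
  cases ε s <;> cases ε t <;> simp [pow_succ] <;> norm_num

/-- The moments of the roots of unity factor over the distinct indices. -/
theorem average_prod_rootPow {p : ℕ} {V : Type*} [Fintype V] [DecidableEq V] (ε : Fin p → Bool)
    (d : Fin p → V) :
    ((4 : ℂ) ^ Fintype.card V)⁻¹ * ∑ ω : V → Fin 4, ∏ s, rootPow (ε s) (ω (d s)) =
      ∏ v ∈ Finset.univ.image d, rootMoment ε (Finset.univ.filter fun s => d s = v) := by
  have h1 : ∀ ω : V → Fin 4, ∏ s, rootPow (ε s) (ω (d s)) =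
      ∏ v, ∏ s ∈ Finset.univ.filter (fun s => d s = v), rootPow (ε s) (ω v) := by
    intro ω
    rw [← Finset.prod_fiberwise Finset.univ d]
    refine Finset.prod_congr rfl fun v _ => Finset.prod_congr rfl fun s hs => ?_
    rw [(Finset.mem_filter.1 hs).2]
  have h2 := Finset.prod_univ_sum (fun _ : V => (Finset.univ : Finset (Fin 4)))
    (fun v q => ∏ s ∈ Finset.univ.filter (fun s => d s = v), rootPow (ε s) q)
  rw [Fintype.piFinset_univ] at h2
  rw [Finset.sum_congr rfl fun ω _ => h1 ω, ← h2, ← inv_pow, ← Finset.card_univ,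
    ← Finset.prod_const, ← Finset.prod_mul_distrib]
  symm
  refine Finset.prod_subset (Finset.subset_univ _) fun v _ hv => ?_
  rw [Finset.filter_eq_empty_iff.2]
  · simp [rootMoment]
  · intro s _ hs
    exact hv (Finset.mem_image.2 ⟨s, Finset.mem_univ _, hs⟩)

/-- The phase `exp (i π k / n)` for the second label, and `1` for the first one. -/
noncomputable def labelPhase (n : ℕ) (a : Fin 2) (k : ℤ) : ℂ :=
  if a = 1 then Complex.exp (Complex.I * Real.pi * ((k : ℂ) / n)) else 1

theorem labelPhase_mul (n : ℕ) (a : Fin 2) (k l : ℤ) :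
    labelPhase n a k * labelPhase n a l = labelPhase n a (k + l) := by
  unfold labelPhase
  split_ifs
  · rw [← Complex.exp_add]
    push_cast
    ring_nf
  · simp

theorem conj_labelPhase (n : ℕ) (a : Fin 2) (k : ℤ) :
    starRingEnd ℂ (labelPhase n a k) = labelPhase n a (-k) := by
  unfold labelPhase
  split_ifs
  · rw [← Complex.exp_conj]
    simp [neg_div]
  · simp

/-- A random circulant matrix (`a = 0`) and a random skew-circulant matrix (`a = 1`). -/
noncomputable def modelMatrix (n : ℕ) (a : Fin 2) (ω : ModelSpace n) : Matrix (Fin n) (Fin n) ℂ :=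
  Matrix.of fun i j => ((Real.sqrt n : ℝ) : ℂ)⁻¹ *
    (labelPhase n a ((j : ℤ) - i) * rootPow false (ω (a, j - i)))

theorem modelMatrix_letter (n : ℕ) (a : Fin 2) (ω : ModelSpace n) (e : Bool) (i j : Fin n) :
    (if e then star (modelMatrix n a ω) else modelMatrix n a ω) i j =
      ((Real.sqrt n : ℝ) : ℂ)⁻¹ * (labelPhase n a ((j : ℤ) - i) *
        rootPow e (ω (a, if e then i - j else j - i))) := by
  cases e
  · simp [modelMatrix]
  · simp only [if_true, Matrix.star_apply, modelMatrix, Matrix.of_apply]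
    rw [star_mul', star_mul', ← starRingEnd_apply, ← starRingEnd_apply, ← starRingEnd_apply,
      conj_labelPhase, map_inv₀, Complex.conj_ofReal]
    simp [rootPow]

/-- The phase of a two-step path depends only on its endpoints, and circulants commute. -/
theorem modelMatrix_mul_star (n : ℕ) (a : Fin 2) (ω : ModelSpace n) :
    modelMatrix n a ω * star (modelMatrix n a ω) =
      star (modelMatrix n a ω) * modelMatrix n a ω := by
  ext i j
  have : NeZero n := ⟨i.pos.ne'⟩
  have h1 := fun i j => modelMatrix_letter n a ω true i j
  have h2 := fun i j => modelMatrix_letter n a ω false i j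
  simp only [if_true, Bool.false_eq_true, if_false] at h1 h2
  simp only [Matrix.mul_apply, h1, h2]
  -- The reflection k ↦ i + j - k exchanges the two index differences.
  rw [← (Equiv.subLeft (i + j)).sum_comp]
  refine Finset.sum_congr rfl fun k _ => ?_
  simp only [Equiv.subLeft_apply]
  have e1 : i + j - k - i = j - k := by abel
  have e2 : i + j - k - j = i - k := by abel
  rw [e1, e2]
  generalize hm : i + j - k = m
  have h3 := labelPhase_mul n a ((m : ℤ) - i) ((j : ℤ) - m)
  have h4 := labelPhase_mul n a ((k : ℤ) - i) ((j : ℤ) - k)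
  rw [show (m : ℤ) - i + (j - m) = (k : ℤ) - i + (j - k) by ring, ← h4] at h3
  linear_combination ((Real.sqrt n : ℝ) : ℂ)⁻¹ ^ 2 * rootPow false (ω (a, j - k)) *
    rootPow true (ω (a, i - k)) * h3

/-- The functional `n⁻¹ E Tr` of the model. -/
noncomputable def modelTrace (n : ℕ) : (ModelSpace n → Matrix (Fin n) (Fin n) ℂ) →ₗ[ℂ] ℂ where
  toFun M := (n : ℂ)⁻¹ * (((4 : ℂ) ^ Fintype.card (Fin 2 × Fin n))⁻¹ * ∑ ω, (M ω).trace)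
  map_add' M M' := by simp [Matrix.trace_add, Finset.sum_add_distrib, mul_add]
  map_smul' c M := by
    simp only [Pi.smul_apply, Matrix.trace_smul, smul_eq_mul, RingHom.id_apply, ← Finset.mul_sum]
    ring

theorem modelTrace_one {n : ℕ} (hn : 0 < n) : modelTrace n 1 = 1 := by
  have : (n : ℂ) ≠ 0 := by exact_mod_cast hn.ne'
  simp [modelTrace]
  field_simp

open scoped ComplexOrder in
theorem modelTrace_star_mul_self_nonneg {n : ℕ} (M : ModelSpace n → Matrix (Fin n) (Fin n) ℂ) :
    0 ≤ modelTrace n (star M * M) := by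
  simp only [modelTrace, LinearMap.coe_mk, AddHom.coe_mk]
  refine mul_nonneg (by simp) (mul_nonneg (by simp) (Finset.sum_nonneg fun ω _ => ?_))
  exact (Matrix.posSemidef_conjTranspose_mul_self (M ω)).trace_nonneg

/-- The moments of the model, as sums over closed paths. -/
noncomputable def modelMoment {p : ℕ} (a : Fin p → Fin 2) (ε : Fin p → Bool) (n : ℕ) : ℂ :=
  (n : ℂ)⁻¹ * ((Real.sqrt n : ℝ) : ℂ)⁻¹ ^ p * ∑ x ∈ closedPaths p n, pathPhase a x *
    (((4 : ℂ) ^ Fintype.card (Fin 2 × Fin n))⁻¹ *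
      ∑ ω : ModelSpace n, ∏ s, rootPow (ε s) (ω (a s, mstep ε x s)))

theorem modelMoment_eq {p n : ℕ} (a : Fin p → Fin 2) (ε : Fin p → Bool) :
    modelMoment a ε n = (n : ℂ)⁻¹ * (((4 : ℂ) ^ Fintype.card (Fin 2 × Fin n))⁻¹ *
      ∑ ω, ∑ x ∈ closedPaths p n, ∏ s,
        (if ε s then star (modelMatrix n (a s) ω) else modelMatrix n (a s) ω)
          (x s.castSucc) (x s.succ)) := by
  have h : ∀ (ω : ModelSpace n) (x : Fin (p + 1) → Fin n), ∏ s,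
      (if ε s then star (modelMatrix n (a s) ω) else modelMatrix n (a s) ω)
        (x s.castSucc) (x s.succ) = ((Real.sqrt n : ℝ) : ℂ)⁻¹ ^ p * (pathPhase a x *
          ∏ s, rootPow (ε s) (ω (a s, mstep ε x s))) := by
    intro ω x
    simp only [modelMatrix_letter]
    rw [Finset.prod_mul_distrib, Finset.prod_mul_distrib, Finset.prod_const, Finset.card_univ,
      Fintype.card_fin]
    rfl
  simp only [h, modelMoment, ← Finset.mul_sum]
  rw [Finset.sum_comm]
  simp only [Finset.mul_sum]
  refine Finset.sum_congr rfl fun x _ => Finset.sum_congr rfl fun ω _ => ?_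
  ring

/-- The random index of a step is the pair (label, step modulo n). A pair partition therefore
survives only if labels agree, exponents differ and steps match modulo n along it. -/
theorem tendsto_modelMoment {p : ℕ} (a : Fin p → Fin 2) (ε : Fin p → Bool) :
    Tendsto (modelMoment a ε) atTop (𝓝 (limitMoment a ε)) := by
  have h := tendsto_sum_paths_sub (p := p) (V := fun n => Fin 2 × Fin n)
    (fun n x s => (a s, mstep ε x s)) (fun n => Finset.univ) (fun _ _ _ => Finset.mem_univ _)
    -- There are 2n random indices; the allowance 3n also covers the 2n + 1 integers of the Toeplitz
    -- case.
    (fun n _ => by simp; omega)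
    (fun n x y h0 h => path_ext_of_mstep h0 fun s => (Prod.mk.inj (h s)).2)
    (fun s t => ε t ≠ ε s) (C := 1 ^ p + p.factorial)
    (fun n x => ((4 : ℂ) ^ Fintype.card (Fin 2 × Fin n))⁻¹ *
      ∑ ω : ModelSpace n, ∏ s, rootPow (ε s) (ω (a s, mstep ε x s)))
    (fun n x => pathPhase a x) (fun n x => (norm_pathPhase a x).le) (fun n x => by
      rw [average_prod_rootPow]
      exact norm_prod_fiber_sub_card_le (fun s => (a s, mstep ε x s))
        (fun _ S => rootMoment ε S) (fun s t => ε t ≠ ε s) le_rfl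
        (fun _ s => rootMoment_singleton ε s) (fun _ s t hst => rootMoment_pair ε s t hst)
        (fun _ S => norm_rootMoment_le ε S))
  have h2 : Tendsto (fun n : ℕ => ∑ π ∈ (pairings p).filter (fun π => ∀ s, ε (π s) ≠ ε s),
      (n : ℂ)⁻¹ * ((Real.sqrt n : ℝ) : ℂ)⁻¹ ^ p *
        ∑ x ∈ (closedPaths p n).filter
          (fun x => ∀ s, (a (π s), mstep ε x (π s)) = (a s, mstep ε x s)), pathPhase a x) atTop
      (𝓝 (limitMoment a ε)) := by
    have h3 : limitMoment a ε = ∑ π ∈ (pairings p).filter (fun π => ∀ s, ε (π s) ≠ ε s),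
        if ∀ s, a (π s) = a s then
          fractExpIntegral Real.pi (labelCoeff a) (pairingForm π) else 0 := by
      rw [limitMoment, ← Finset.sum_filter, Finset.filter_filter]
      refine Finset.sum_congr (Finset.filter_congr fun π _ => ?_) fun _ _ => rfl
      rw [forall_and, and_comm]
    rw [h3]
    refine tendsto_finsetSum _ fun π hπ => ?_
    obtain ⟨hπ, hε⟩ := Finset.mem_filter.1 hπ
    simp only [Prod.mk.injEq, forall_and]
    split_ifs with ha
    · simp only [ha, implies_true, true_and]
      exact tendsto_sum_matched_pathPhase hπ hε a
    · simp [ha]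
  have h4 := h.add h2
  simp only [sub_add_cancel, zero_add] at h4
  exact h4

/-! ### The limit `*`-probability space. -/

/-- Sequences of random matrices over the model spaces. -/
abbrev ModelSeq : Type := ∀ n : ℕ, ModelSpace n → Matrix (Fin n) (Fin n) ℂ

/-- The sequences of the circulant and of the skew-circulant model matrices. -/
noncomputable def modelGen (a : Fin 2) : ModelSeq := fun n ω => modelMatrix n a ω

/-- The `*`-algebra generated by the model matrices. -/
noncomputable def modelAlgebra : StarSubalgebra ℂ ModelSeq :=
  StarAlgebra.adjoin ℂ (Set.range modelGen)

theorem modelTrace_evalWord {ι : Type*} (B : ι → ModelSeq) (w : List (ι × Bool)) (n : ℕ) :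
    modelTrace n (evalWord B w n) = (n : ℂ)⁻¹ * (((4 : ℂ) ^ Fintype.card (Fin 2 × Fin n))⁻¹ *
      ∑ ω, ∑ x ∈ closedPaths w.length n, ∏ s,
        (if (w.get s).2 then star (B (w.get s).1 n ω) else B (w.get s).1 n ω)
          (x s.castSucc) (x s.succ)) := by
  have h : ∀ ω, evalWord B w n ω = evalWord (fun i => B i n ω) w := fun ω =>
    map_evalWord (fun X : ModelSeq => X n ω) rfl (fun _ _ => rfl) (fun _ => rfl) B w
  simp only [modelTrace, LinearMap.coe_mk, AddHom.coe_mk, h]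
  congr 2
  exact Finset.sum_congr rfl fun ω _ => trace_evalWord _ w

theorem tendsto_modelTrace_word (w : List (Fin 2 × Bool)) :
    Tendsto (fun n => modelTrace n (evalWord modelGen w n)) atTop
      (𝓝 (limitMoment (fun s => (w.get s).1) (fun s => (w.get s).2))) := by
  refine (tendsto_modelMoment _ _).congr fun n => ?_
  rw [modelTrace_evalWord, modelMoment_eq]
  rfl

/-- Multilinear expansion over the labels of the letters. The scalar 1/√2 is real, so it also comes
out of the adjoints. -/
theorem tendsto_modelTrace_sum_word (w : List (Unit × Bool)) :
    Tendsto (fun n => modelTrace n (evalWord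
        (fun _ : Unit => ((Real.sqrt 2 : ℝ) : ℂ)⁻¹ • (modelGen 0 + modelGen 1)) w n)) atTop
      (𝓝 (((Real.sqrt 2 : ℝ) : ℂ)⁻¹ ^ w.length * ∑ a : Fin w.length → Fin 2,
        limitMoment a (fun s => (w.get s).2))) := by
  refine ((tendsto_finsetSum Finset.univ fun (a : Fin w.length → Fin 2) _ =>
    tendsto_modelMoment a fun s => (w.get s).2).const_mul _).congr fun n => ?_
  rw [modelTrace_evalWord]
  have h : ∀ (ω : ModelSpace n) (s : Fin w.length) (i j : Fin n),
      (if (w.get s).2 then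
        star ((((Real.sqrt 2 : ℝ) : ℂ)⁻¹ • (modelGen 0 + modelGen 1)) n ω)
        else (((Real.sqrt 2 : ℝ) : ℂ)⁻¹ • (modelGen 0 + modelGen 1)) n ω) i j =
      ((Real.sqrt 2 : ℝ) : ℂ)⁻¹ * ∑ a : Fin 2,
        (if (w.get s).2 then star (modelMatrix n a ω) else modelMatrix n a ω) i j := by
    intro ω s i j
    have hc : star (((Real.sqrt 2 : ℝ) : ℂ)⁻¹) = ((Real.sqrt 2 : ℝ) : ℂ)⁻¹ := by
      rw [star_inv₀, ← starRingEnd_apply, Complex.conj_ofReal]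
    rw [Fin.sum_univ_two]
    split_ifs
    · simp only [Pi.smul_apply, Pi.add_apply, modelGen, star_smul, star_add, hc]
      simp
    · simp [modelGen]
  simp only [h, Finset.prod_mul_distrib, Finset.prod_univ_sum, Fintype.piFinset_univ,
    Finset.prod_const, Finset.card_univ, Fintype.card_fin]
  simp only [modelMoment_eq, ← Finset.mul_sum]
  have h2 : ∀ ω : ModelSpace n, ∑ x ∈ closedPaths w.length n, ∑ a : Fin w.length → Fin 2,
      ∏ s, (if (w.get s).2 then star (modelMatrix n (a s) ω) else modelMatrix n (a s) ω)
        (x s.castSucc) (x s.succ) = ∑ a : Fin w.length → Fin 2, ∑ x ∈ closedPaths w.length n,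
      ∏ s, (if (w.get s).2 then star (modelMatrix n (a s) ω) else modelMatrix n (a s) ω)
        (x s.castSucc) (x s.succ) := fun ω => Finset.sum_comm
  rw [Finset.sum_congr rfl fun ω _ => h2 ω, Finset.sum_comm (s := Finset.univ)]
  ring

theorem exists_evalWord_of_mem_closure {x : ModelSeq}
    (hx : x ∈ Submonoid.closure (Set.range modelGen ∪ star (Set.range modelGen))) :
    ∃ w : List (Fin 2 × Bool), evalWord modelGen w = x := by
  induction hx using Submonoid.closure_induction with
  | mem x hx =>
    rcases hx with ⟨a, rfl⟩ | ⟨a, ha⟩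
    · exact ⟨[(a, false)], by simp [evalWord]⟩
    · exact ⟨[(a, true)], by simp [evalWord, ha]⟩
  | one => exact ⟨[], rfl⟩
  | mul x y _ _ hx hy =>
    obtain ⟨w, rfl⟩ := hx
    obtain ⟨w', rfl⟩ := hy
    exact ⟨w ++ w', by simp [evalWord]⟩

/-- The generated algebra is the linear span of the words, and the traces of words converge. -/
theorem exists_tendsto_modelTrace {x : ModelSeq} (hx : x ∈ modelAlgebra) :
    ∃ c, Tendsto (fun n => modelTrace n (x n)) atTop (𝓝 c) := by
  have hx' : x ∈ Submodule.span ℂ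
      (Submonoid.closure (Set.range modelGen ∪ star (Set.range modelGen)) : Set ModelSeq) := by
    rw [← StarAlgebra.adjoin_eq_span]
    exact hx
  clear hx
  induction hx' using Submodule.span_induction with
  | mem x h =>
    obtain ⟨w, rfl⟩ := exists_evalWord_of_mem_closure h
    exact ⟨_, tendsto_modelTrace_word w⟩
  | zero => exact ⟨0, by simp⟩
  | add x y _ _ h1 h2 =>
    obtain ⟨c, hc⟩ := h1
    obtain ⟨c', hc'⟩ := h2
    exact ⟨c + c', by simpa using hc.add hc'⟩
  | smul r x _ h1 =>
    obtain ⟨c, hc⟩ := h1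
    exact ⟨r * c, by simpa using hc.const_mul r⟩

/-- The limit of the functionals `n⁻¹ E Tr` on the model. -/
noncomputable def modelState (x : modelAlgebra) : ℂ :=
  limUnder atTop fun n => modelTrace n (x.1 n)

theorem tendsto_modelState (x : modelAlgebra) :
    Tendsto (fun n => modelTrace n (x.1 n)) atTop (𝓝 (modelState x)) :=
  tendsto_nhds_limUnder (exists_tendsto_modelTrace x.2)

open scoped ComplexOrder in
theorem modelState_star_mul_self (x : modelAlgebra) :
    0 ≤ (modelState (star x * x)).re ∧ (modelState (star x * x)).im = 0 := by
  have h := tendsto_modelState (star x * x)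
  have hn : ∀ n, 0 ≤ modelTrace n ((star x * x : modelAlgebra).1 n) := fun n =>
    modelTrace_star_mul_self_nonneg (x.1 n)
  constructor
  · exact ge_of_tendsto' ((Complex.continuous_re.tendsto _).comp h)
      fun n => (Complex.nonneg_iff.1 (hn n)).1
  · refine tendsto_nhds_unique ((Complex.continuous_im.tendsto _).comp h) ?_
    refine tendsto_const_nhds.congr fun n => ?_
    exact (Complex.nonneg_iff.1 (hn n)).2

/-- The limit of the circulant and skew-circulant model as a `*`-probability space. -/
noncomputable def modelProbSpace : NCProbSpace where
  carrier := modelAlgebra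
  state :=
    { toFun := modelState
      map_add' := fun x y => tendsto_nhds_unique (tendsto_modelState (x + y)) (by
        simpa using (tendsto_modelState x).add (tendsto_modelState y))
      map_smul' := fun c x => tendsto_nhds_unique (tendsto_modelState (c • x)) (by
        simpa using (tendsto_modelState x).const_mul c) }
  state_one := by
    refine tendsto_nhds_unique (tendsto_modelState 1) (tendsto_const_nhds.congr' ?_)
    filter_upwards [eventually_gt_atTop 0] with n hn
    exact (modelTrace_one hn).symm
  state_nonneg := modelState_star_mul_self

/-- The limit of the circulant (`a = 0`) and of the skew-circulant (`a = 1`) matrices. -/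
noncomputable def modelVar (a : Fin 2) : modelProbSpace.carrier :=
  (⟨modelGen a, StarAlgebra.subset_adjoin ℂ _ ⟨a, rfl⟩⟩ : modelAlgebra)

theorem modelVar_mul_star (a : Fin 2) :
    modelVar a * star (modelVar a) = star (modelVar a) * modelVar a :=
  Subtype.ext (funext fun n => funext fun ω => modelMatrix_mul_star n a ω)

theorem modelState_evalWord {ι : Type*} (B : ι → modelAlgebra) (w : List (ι × Bool)) {c : ℂ}
    (h : Tendsto (fun n => modelTrace n (evalWord (fun i => (B i).1) w n)) atTop (𝓝 c)) :
    modelState (evalWord B w) = c := by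
  refine tendsto_nhds_unique (tendsto_modelState _) ?_
  have h2 : (evalWord B w).1 = evalWord (fun i => (B i).1) w :=
    map_evalWord (fun X : modelAlgebra => X.1) rfl (fun _ _ => rfl) (fun _ => rfl) B w
  rw [h2]
  exact h

theorem state_evalWord_modelVar (w : List (Fin 2 × Bool)) :
    modelProbSpace.state (evalWord ![modelVar 0, modelVar 1] w) =
      limitMoment (fun s => (w.get s).1) (fun s => (w.get s).2) := by
  have h : ![modelVar 0, modelVar 1] = modelVar := by
    funext a; fin_cases a <;> rfl
  rw [h]
  exact modelState_evalWord (ι := Fin 2) modelVar w (tendsto_modelTrace_word w)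

theorem state_evalWord_sum_modelVar (w : List (Unit × Bool)) :
    modelProbSpace.state
      (evalWord (fun _ : Unit => ((Real.sqrt 2 : ℝ) : ℂ)⁻¹ • (modelVar 0 + modelVar 1)) w) =
      ((Real.sqrt 2 : ℝ) : ℂ)⁻¹ ^ w.length * ∑ a : Fin w.length → Fin 2,
        limitMoment a (fun s => (w.get s).2) :=
  modelState_evalWord (ι := Unit)
    (fun _ => ((Real.sqrt 2 : ℝ) : ℂ)⁻¹ • (modelVar 0 + modelVar 1)) w
    (tendsto_modelTrace_sum_word w)

/-! ### Moments of the Toeplitz matrices. -/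

theorem AssumptionI.memLp {Ω : Type*} [MeasurableSpace Ω] {P : Measure Ω}
    {τ : ℤ → Ω → ℝ} (hτ : AssumptionI P τ) (k : ℕ) (j : ℤ) : MemLp (τ j) k P := by
  have hm := (hτ.measurable j).aestronglyMeasurable (μ := P)
  rcases Nat.eq_zero_or_pos k with rfl | hk
  · simpa using hm
  · rw [← integrable_norm_rpow_iff hm (by exact_mod_cast hk.ne') (by simp)]
    simpa using hτ.integrable_pow k j

theorem hasAllMoments_smul_toeplitz {Ω : Type*} [MeasurableSpace Ω] {P : Measure Ω}
    {τ : ℤ → Ω → ℝ} (hτ : AssumptionI P τ) (n : ℕ) (c : ℂ) :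
    HasAllMoments P (c • toeplitz τ n) := fun i j k =>
  ((hτ.memLp k ((j : ℤ) - i)).ofReal (K := ℂ)).const_mul c

theorem AssumptionI.integrable_prod {Ω : Type*} [MeasurableSpace Ω] {P : Measure Ω}
    [IsProbabilityMeasure P] {τ : ℤ → Ω → ℝ} (hτ : AssumptionI P τ) {p : ℕ} (d : Fin p → ℤ) :
    Integrable (fun ω => ∏ s, τ (d s) ω) P := by
  have h := MemLp.prod' (s := Finset.univ) (f := fun s => τ (d s)) (p := fun _ => (p : ENNReal))
    fun s _ => hτ.memLp p (d s)
  -- Hölder with p factors in L^p. For p = 0 the resulting exponent is ∞, hence an inequality rather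
  -- than exponent 1.
  refine memLp_one_iff_integrable.1 (h.mono_exponent ?_)
  rw [Finset.sum_const, Finset.card_univ, Fintype.card_fin, nsmul_eq_mul, ENNReal.one_le_inv]
  exact ENNReal.mul_inv_le_one _

theorem AssumptionI.integral_prod {Ω : Type*} [MeasurableSpace Ω] {P : Measure Ω}
    {τ : ℤ → Ω → ℝ} (hτ : AssumptionI P τ) {p : ℕ} (d : Fin p → ℤ) :
    ∫ ω, ∏ s, τ (d s) ω ∂P = ∏ v ∈ Finset.univ.image d,
      ∫ ω, τ v ω ^ (Finset.univ.filter fun s => d s = v).card ∂P := by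
  have h1 : ∀ ω, ∏ s, τ (d s) ω = ∏ v : {v // v ∈ Finset.univ.image d},
      τ v.1 ω ^ (Finset.univ.filter fun s => d s = v.1).card := by
    intro ω
    rw [Finset.prod_comp (fun v => τ v ω) d]
    exact (Finset.prod_coe_sort (Finset.univ.image d) fun v =>
      τ v ω ^ (Finset.univ.filter fun s => d s = v).card).symm
  simp only [h1]
  have hind := (hτ.indep.precomp (g := fun v : {v // v ∈ Finset.univ.image d} => v.1)
    Subtype.val_injective).comp
    (fun v t => t ^ (Finset.univ.filter fun s => d s = v.1).card) (fun v => by fun_prop)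
  have h2 := hind.integral_fun_prod_eq_prod_integral
    (fun v => ((hτ.measurable v.1).pow_const _).aestronglyMeasurable)
  rw [← Finset.prod_coe_sort]
  exact h2

theorem AssumptionI.exists_moment_bound {Ω : Type*} [MeasurableSpace Ω] {P : Measure Ω}
    [IsProbabilityMeasure P] {τ : ℤ → Ω → ℝ} (hτ : AssumptionI P τ) (p : ℕ) :
    ∃ K : ℝ, 1 ≤ K ∧ ∀ k ≤ p, ∀ j, |∫ ω, τ j ω ^ k ∂P| ≤ K := by
  choose C hC using hτ.bounded_moments
  refine ⟨1 + ∑ k ∈ Finset.range (p + 1), |C k|, ?_, fun k hk j => ?_⟩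
  · have := Finset.sum_nonneg fun k (_ : k ∈ Finset.range (p + 1)) => abs_nonneg (C k)
    linarith
  · have h1 : |∫ ω, τ j ω ^ k ∂P| ≤ ∫ ω, |τ j ω| ^ k ∂P := by
      refine (abs_integral_le_integral_abs).trans_eq ?_
      simp [abs_pow]
    have h2 := Finset.single_le_sum (f := fun k => |C k|) (fun k _ => abs_nonneg _)
      (Finset.mem_range.2 (Nat.lt_succ_of_le hk))
    have h3 := hC k j
    have h4 := le_abs_self (C k)
    linarith

/-- The expectation of a product of the `τ j` counts the compatible pair partitions, up to an
error on the products with few distinct factors. -/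
theorem AssumptionI.exists_norm_integral_prod_sub_le {Ω : Type*} [MeasurableSpace Ω] {P : Measure Ω}
    [IsProbabilityMeasure P] {τ : ℤ → Ω → ℝ} (hτ : AssumptionI P τ) (p : ℕ) :
    ∃ C : ℝ, ∀ d : Fin p → ℤ, ‖((∫ ω, ∏ s, τ (d s) ω ∂P : ℝ) : ℂ) -
      (((pairings p).filter fun π => (∀ s, d (π s) = d s) ∧ ∀ _ : Fin p, True).card : ℂ)‖ ≤
      if 2 * (Finset.univ.image d).card < p then C else 0 := by
  obtain ⟨K, hK1, hK⟩ := hτ.exists_moment_bound p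
  refine ⟨K ^ p + p.factorial, fun d => ?_⟩
  rw [hτ.integral_prod, Complex.ofReal_prod]
  refine norm_prod_fiber_sub_card_le d (fun v S => ((∫ ω, τ v ω ^ S.card ∂P : ℝ) : ℂ))
    (fun _ _ => True) hK1 (fun v s => ?_) (fun v s t hst => ?_) (fun v S => ?_)
  · simp [hτ.mean_zero v]
  · rw [Finset.card_pair hst, if_pos trivial]
    have h := variance_of_integral_eq_zero (hτ.measurable v).aemeasurable (hτ.mean_zero v)
    rw [hτ.variance_one v] at h
    rw [← h, Complex.ofReal_one]
  · rw [Complex.norm_real]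
    exact hK _ ((Finset.card_le_univ S).trans_eq (Fintype.card_fin p)) v

/-- The entries are real, so an adjoint only reverses the step; this is the sign in `zstep`. The
factor 1 is a trivial phase, in the format of `tendsto_sum_paths_sub`. -/
theorem expTrace_evalWord_toeplitz {Ω : Type*} [MeasurableSpace Ω] {P : Measure Ω}
    [IsProbabilityMeasure P] {τ : ℤ → Ω → ℝ} (hτ : AssumptionI P τ) (w : List (Unit × Bool)) (n : ℕ) :
    expTrace P n (evalWord (fun _ : Unit => ((Real.sqrt n : ℝ) : ℂ)⁻¹ • toeplitz τ n) w) =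
      (n : ℂ)⁻¹ * ((Real.sqrt n : ℝ) : ℂ)⁻¹ ^ w.length * ∑ x ∈ closedPaths w.length n,
        1 * ((∫ ω, ∏ s, τ (zstep (fun s => (w.get s).2) x s) ω ∂P : ℝ) : ℂ) := by
  have h : ∀ ω, (evalWord (fun _ : Unit => ((Real.sqrt n : ℝ) : ℂ)⁻¹ • toeplitz τ n) w ω).trace =
      ∑ x ∈ closedPaths w.length n, ((Real.sqrt n : ℝ) : ℂ)⁻¹ ^ w.length *
        ((∏ s, τ (zstep (fun s => (w.get s).2) x s) ω : ℝ) : ℂ) := by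
    intro ω
    have h1 : evalWord (fun _ : Unit => ((Real.sqrt n : ℝ) : ℂ)⁻¹ • toeplitz τ n) w ω =
        evalWord (fun _ : Unit => ((Real.sqrt n : ℝ) : ℂ)⁻¹ • toeplitz τ n ω) w :=
      map_evalWord (fun X : Ω → Matrix (Fin n) (Fin n) ℂ => X ω) rfl (fun _ _ => rfl)
        (fun _ => rfl) _ w
    rw [h1, trace_evalWord]
    refine Finset.sum_congr rfl fun x _ => ?_
    have h2 : ∀ s : Fin w.length, (if (w.get s).2 then
        star (((Real.sqrt n : ℝ) : ℂ)⁻¹ • toeplitz τ n ω)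
        else ((Real.sqrt n : ℝ) : ℂ)⁻¹ • toeplitz τ n ω) (x s.castSucc) (x s.succ) =
        ((Real.sqrt n : ℝ) : ℂ)⁻¹ * ((τ (zstep (fun s => (w.get s).2) x s) ω : ℝ) : ℂ) := by
      intro s
      unfold zstep
      split_ifs
      · rw [Matrix.star_apply, Matrix.smul_apply, smul_eq_mul, star_mul', ← starRingEnd_apply,
          ← starRingEnd_apply, map_inv₀, Complex.conj_ofReal, toeplitz, Matrix.of_apply,
          Complex.conj_ofReal]
      · rfl
    rw [Finset.prod_congr rfl fun s _ => h2 s, Finset.prod_mul_distrib, Finset.prod_const,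
      Finset.card_univ, Fintype.card_fin, Complex.ofReal_prod]
  simp only [expTrace, h]
  have hint : ∀ x : Fin (w.length + 1) → Fin n, Integrable (fun ω =>
      ((Real.sqrt n : ℝ) : ℂ)⁻¹ ^ w.length *
        ((∏ s, τ (zstep (fun s => (w.get s).2) x s) ω : ℝ) : ℂ)) P := fun x =>
    (Integrable.ofReal (𝕜 := ℂ) (hτ.integrable_prod _)).const_mul _
  rw [integral_finsetSum _ fun x _ => hint x]
  simp only [integral_const_mul, integral_complex_ofReal, ← Finset.mul_sum, one_mul, mul_assoc]

theorem inv_sqrt_two_pow_eq {p : ℕ} {π : Equiv.Perm (Fin p)} (hπ : π ∈ pairings p) :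
    ((Real.sqrt 2 : ℝ) : ℂ)⁻¹ ^ p = (2 ^ Fintype.card {s : Fin p // s < π s})⁻¹ := by
  conv_lhs => rw [← two_mul_card_pairs hπ]
  rw [inv_pow, pow_mul, ← Complex.ofReal_pow, Real.sq_sqrt (by norm_num)]
  norm_num

/-- The matched paths of the Toeplitz matrices, for a pair partition that joins opposite signs. -/
theorem tendsto_card_matched_zstep {p : ℕ} {π : Equiv.Perm (Fin p)} (hπ : π ∈ pairings p)
    {ε : Fin p → Bool} (hε : ∀ s, ε (π s) ≠ ε s) :
    Tendsto (fun n : ℕ => (n : ℂ)⁻¹ * ((Real.sqrt n : ℝ) : ℂ)⁻¹ ^ p *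
      ∑ _x ∈ (closedPaths p n).filter (fun x => ∀ s, zstep ε x (π s) = zstep ε x s), (1 : ℂ)) atTop
      (𝓝 (((Real.sqrt 2 : ℝ) : ℂ)⁻¹ ^ p *
        ∑ a ∈ Finset.univ.filter (fun a : Fin p → Fin 2 => ∀ s, a (π s) = a s),
          fractExpIntegral Real.pi (labelCoeff a) (pairingForm π))) := by
  refine ((tendsto_finsetSum _ fun a _ =>
    tendsto_sum_matched_pathPhase hπ hε a).const_mul _).congr fun n => ?_
  -- Integer matching implies matching modulo n, and among the latter paths the normalized label
  -- average of the phases is its indicator.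
  have h1 : ∑ x ∈ (closedPaths p n).filter (fun x => ∀ s, zstep ε x (π s) = zstep ε x s), (1 : ℂ) =
      ∑ x ∈ (closedPaths p n).filter (fun x => ∀ s, mstep ε x (π s) = mstep ε x s),
        ((Real.sqrt 2 : ℝ) : ℂ)⁻¹ ^ p *
        ∑ a ∈ Finset.univ.filter (fun a : Fin p → Fin 2 => ∀ s, a (π s) = a s), pathPhase a x := by
    have h2 : ∀ x ∈ (closedPaths p n).filter (fun x => ∀ s, mstep ε x (π s) = mstep ε x s),
        ((Real.sqrt 2 : ℝ) : ℂ)⁻¹ ^ p *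
          ∑ a ∈ Finset.univ.filter (fun a : Fin p → Fin 2 => ∀ s, a (π s) = a s),
            pathPhase a x = if ∀ s, zstep ε x (π s) = zstep ε x s then 1 else 0 := by
      intro x hx
      rw [sum_labels_pathPhase hπ ε hε x (Finset.mem_filter.1 hx).2, inv_sqrt_two_pow_eq hπ]
      split_ifs
      · exact inv_mul_cancel₀ (pow_ne_zero _ two_ne_zero)
      · simp
    rw [Finset.sum_congr rfl h2, ← Finset.sum_filter, Finset.filter_filter]
    refine Finset.sum_congr (Finset.filter_congr fun x _ => ?_) fun _ _ => rfl
    refine ⟨fun h => ⟨fun s => ?_, h⟩, fun h => h.2⟩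
    rw [mstep_eq_iff, h s, sub_self]
    exact dvd_zero _
  rw [h1, ← Finset.mul_sum, ← Finset.mul_sum, Finset.sum_comm]
  ring

/-- The `*`-moments of the normalized Toeplitz matrices converge. -/
theorem tendsto_expTrace_toeplitz {Ω : Type*} [MeasurableSpace Ω] {P : Measure Ω}
    [IsProbabilityMeasure P] {τ : ℤ → Ω → ℝ} (hτ : AssumptionI P τ) (w : List (Unit × Bool)) :
    Tendsto (fun n => expTrace P n
        (evalWord (fun _ : Unit => ((Real.sqrt n : ℝ) : ℂ)⁻¹ • toeplitz τ n) w)) atTop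
      (𝓝 (((Real.sqrt 2 : ℝ) : ℂ)⁻¹ ^ w.length * ∑ a : Fin w.length → Fin 2,
        limitMoment a (fun s => (w.get s).2))) := by
  obtain ⟨C, hC⟩ := hτ.exists_norm_integral_prod_sub_le w.length
  set ε : Fin w.length → Bool := fun s => (w.get s).2
  have h := tendsto_sum_paths_sub (p := w.length) (V := fun _ => ℤ) (fun n x => zstep ε x)
    (fun n => Finset.Icc (-(n : ℤ)) n) (fun n x s => zstep_mem_Icc ε x s)
    (fun n hn => card_Icc_neg_le n hn) (fun n x y h0 h => path_ext_of_zstep h0 h)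
    (fun _ _ => True) (C := C) (fun n x => ((∫ ω, ∏ s, τ (zstep ε x s) ω ∂P : ℝ) : ℂ))
    (fun _ _ => 1) (fun _ _ => by simp) (fun n x => hC _)
  have h2 : Tendsto (fun n : ℕ => ∑ π ∈ (pairings w.length).filter (fun _ => ∀ _ : Fin w.length, True),
      (n : ℂ)⁻¹ * ((Real.sqrt n : ℝ) : ℂ)⁻¹ ^ w.length *
        ∑ x ∈ (closedPaths w.length n).filter (fun x => ∀ s, zstep ε x (π s) = zstep ε x s),
          (1 : ℂ)) atTop
      (𝓝 (((Real.sqrt 2 : ℝ) : ℂ)⁻¹ ^ w.length * ∑ a : Fin w.length → Fin 2,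
        limitMoment a ε)) := by
    have h3 : ((Real.sqrt 2 : ℝ) : ℂ)⁻¹ ^ w.length * ∑ a : Fin w.length → Fin 2,
        limitMoment a ε = ∑ π ∈ (pairings w.length).filter (fun _ => ∀ _ : Fin w.length, True),
        if ∀ s, ε (π s) ≠ ε s then ((Real.sqrt 2 : ℝ) : ℂ)⁻¹ ^ w.length *
          ∑ a ∈ Finset.univ.filter (fun a : Fin w.length → Fin 2 => ∀ s, a (π s) = a s),
            fractExpIntegral Real.pi (labelCoeff a) (pairingForm π) else 0 := by
      simp only [limitMoment, Finset.sum_filter, forall_and, implies_true, if_true]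
      rw [Finset.sum_comm, Finset.mul_sum]
      refine Finset.sum_congr rfl fun π _ => ?_
      split_ifs with h4
      · simp [h4]
      · simp [h4]
    rw [h3]
    refine tendsto_finsetSum _ fun π hπ => ?_
    have hπ := (Finset.mem_filter.1 hπ).1
    split_ifs with hε
    · exact tendsto_card_matched_zstep hπ hε
    -- A pair of equal signs leaves too few paths to contribute.
    · push Not at hε
      have h5 := tendsto_normalized_zero (p := w.length) (C := 3 ^ w.length)
        (fun n => (((closedPaths w.length n).filter
          fun x => ∀ s, zstep ε x (π s) = zstep ε x s).card : ℝ))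
        (fun n => Nat.cast_nonneg _) (fun n => card_closedPaths_pairing_le hπ ε hε)
        (fun h0 => absurd hε (by
          rintro ⟨s, -⟩
          have := s.isLt
          omega))
      refine ((Complex.continuous_ofReal.tendsto _).comp h5).congr fun n => ?_
      simp
  have h4 := h.add h2
  simp only [sub_add_cancel, zero_add] at h4
  exact h4.congr fun n => (expTrace_evalWord_toeplitz hτ w n).symm

/-! ### Gaussian domination of the moments. -/

/-- A fixed-point-free involution has cycle type 2^m, and that conjugacy class has (2m)!/(2^m m!)
elements. -/
theorem card_pairings_two_mul (m : ℕ) :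
    (pairings (2 * m)).card ≤ (2 * m - 1).doubleFactorial := by
  classical
  have hsub : pairings (2 * m) ⊆
      Finset.univ.filter fun π : Equiv.Perm (Fin (2 * m)) =>
        π.cycleType = Multiset.replicate m 2 := by
    intro π hπ
    have h := mem_pairings.1 hπ
    rw [Finset.mem_filter]
    refine ⟨Finset.mem_univ _, ?_⟩
    have h2 : ∀ a ∈ π.cycleType, a = 2 := by
      intro a ha
      have h3 : orderOf π ∣ 2 := orderOf_dvd_of_pow_eq_one (by
        ext s
        simp [pow_two, (h s).1])
      have h4 := Nat.le_of_dvd (by norm_num) ((Equiv.Perm.dvd_of_mem_cycleType ha).trans h3)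
      have h5 := Equiv.Perm.two_le_of_mem_cycleType ha
      omega
    have h6 := Multiset.eq_replicate_card.2 h2
    have h7 := Equiv.Perm.sum_cycleType π
    have h8 : π.support = Finset.univ := by
      ext s
      simp [(h s).2]
    rw [h6, Multiset.sum_replicate, h8, Finset.card_univ, Fintype.card_fin, smul_eq_mul] at h7
    rw [h6]
    congr 1
    omega
  refine (Finset.card_le_card hsub).trans ?_
  have h := Equiv.Perm.card_of_cycleType_mul_eq (Fin (2 * m)) (Multiset.replicate m 2)
  have hprod : ∏ n ∈ (Multiset.replicate m 2).toFinset,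
      (Multiset.count n (Multiset.replicate m 2)).factorial = m.factorial := by
    rcases Nat.eq_zero_or_pos m with rfl | hm
    · simp
    · simp [hm.ne', Multiset.toFinset_replicate]
  rw [hprod, if_pos ⟨by simp [mul_comm], fun a ha => (Multiset.eq_of_mem_replicate ha).ge⟩] at h
  simp only [Fintype.card_fin, Multiset.sum_replicate, smul_eq_mul, Multiset.prod_replicate,
    mul_comm m 2, Nat.sub_self, Nat.factorial_zero, one_mul] at h
  have h2 : (2 * m).factorial =
      (2 * m - 1).doubleFactorial * (2 ^ m * m.factorial) := by
    rcases Nat.eq_zero_or_pos m with rfl | hm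
    · simp
    · obtain ⟨q, rfl⟩ : ∃ q, m = q + 1 := ⟨m - 1, by omega⟩
      rw [← Nat.doubleFactorial_two_mul, mul_comm (Nat.doubleFactorial _)]
      exact Nat.factorial_eq_mul_doubleFactorial (2 * q + 1)
  rw [h2] at h
  exact (Nat.eq_of_mul_eq_mul_right (by positivity) h).le

/-- By evenness the integral reduces to the half line, where it is a multiple of Γ(m + 1/2). -/
theorem integral_pow_two_mul_gaussianReal (m : ℕ) :
    ∫ x, x ^ (2 * m) ∂(gaussianReal 0 1) = (2 * m - 1).doubleFactorial := by
  rw [integral_gaussianReal_eq_integral_smul one_ne_zero]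
  have h1 : ∀ x : ℝ, gaussianPDFReal 0 1 x • x ^ (2 * m) =
      (fun t : ℝ => (√(2 * Real.pi))⁻¹ * (t ^ (2 * m) * Real.exp (-(1 / 2) * t ^ 2))) |x| := by
    intro x
    simp only [gaussianPDFReal_def, smul_eq_mul, sub_zero, NNReal.coe_one, mul_one, pow_mul, sq_abs]
    ring_nf
  refine (integral_congr_ae (ae_of_all _ h1)).trans ((integral_comp_abs (f := fun t : ℝ =>
    (√(2 * Real.pi))⁻¹ * (t ^ (2 * m) * Real.exp (-(1 / 2) * t ^ 2)))).trans ?_)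
  rw [integral_const_mul]
  have h2 : ∫ t in Set.Ioi (0 : ℝ), t ^ (2 * m) * Real.exp (-(1 / 2) * t ^ 2) =
      ∫ t in Set.Ioi (0 : ℝ), t ^ ((2 * m : ℕ) : ℝ) * Real.exp (-(1 / 2) * t ^ (2 : ℝ)) := by
    refine setIntegral_congr_fun measurableSet_Ioi fun t _ => ?_
    simp only [Real.rpow_natCast, Real.rpow_two]
  rw [h2, integral_rpow_mul_exp_neg_mul_rpow (by norm_num)
    (by have : (0 : ℝ) ≤ ((2 * m : ℕ) : ℝ) := Nat.cast_nonneg _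
        linarith) (by norm_num)]
  have h3 : (((2 * m : ℕ) : ℝ) + 1) / 2 = m + 1 / 2 := by push_cast; ring
  have h4 : -(((2 * m : ℕ) : ℝ) + 1) / 2 = -(m + 1 / 2 : ℝ) := by rw [neg_div, h3]
  rw [h3, h4, Real.Gamma_nat_add_half, Real.rpow_neg (by norm_num),
    Real.rpow_add (by norm_num), Real.rpow_natCast, ← Real.sqrt_eq_rpow, Real.sqrt_mul (by norm_num)]
  have h5 : √(1 / 2 : ℝ) = (√2)⁻¹ := by rw [one_div, Real.sqrt_inv]
  have h6 : √Real.pi ≠ 0 := (Real.sqrt_pos.2 Real.pi_pos).ne'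
  have h7 : √(2 : ℝ) ≠ 0 := (Real.sqrt_pos.2 two_pos).ne'
  rw [h5, one_div, inv_pow]
  field_simp

theorem integral_odd_pow_gaussianReal {p : ℕ} (hp : Odd p) :
    ∫ x, x ^ p ∂(gaussianReal 0 1) = 0 := by
  rw [integral_gaussianReal_eq_integral_smul one_ne_zero]
  have h := integral_neg_eq_self (fun x : ℝ => gaussianPDFReal 0 1 x • x ^ p) volume
  have h1 : ∀ x : ℝ, gaussianPDFReal 0 1 (-x) • (-x) ^ p =
      -(gaussianPDFReal 0 1 x • x ^ p) := by
    intro x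
    simp [gaussianPDFReal_def, hp.neg_pow]
  simp only [h1, integral_neg] at h
  linarith

/-- There are no more pair partitions than the standard Gaussian moment. -/
theorem card_pairings_le_integral (p : ℕ) :
    ((pairings p).card : ℝ) ≤ ∫ x, x ^ p ∂(gaussianReal 0 1) := by
  rcases Nat.even_or_odd' p with ⟨m, rfl | rfl⟩
  · rw [integral_pow_two_mul_gaussianReal]
    exact_mod_cast card_pairings_two_mul m
  · rw [integral_odd_pow_gaussianReal ⟨m, rfl⟩, Finset.card_eq_zero.2]
    · simp
    · refine Finset.eq_empty_of_forall_notMem fun π hπ => ?_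
      have := two_mul_card_pairs hπ
      omega

theorem norm_limitMoment_le {p : ℕ} (a : Fin p → Fin 2) (ε : Fin p → Bool) :
    ‖limitMoment a ε‖ ≤ ∫ x, x ^ p ∂(gaussianReal 0 1) := by
  refine le_trans ?_ (card_pairings_le_integral p)
  refine (norm_sum_le_of_le _ fun π _ => norm_fractExpIntegral_le _ _ _).trans ?_
  simp only [Finset.sum_const, nsmul_eq_mul, mul_one]
  exact_mod_cast Finset.card_filter_le _ _

/-! ### Moments of the complex Gaussian law. -/

/-- Density of the standard complex Gaussian law times `z ^ k * conj z ^ l`. -/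
theorem integral_complexGaussian_eq (k l : ℕ) :
    ∫ z : ℝ × ℝ, ((z.1 : ℂ) + z.2 * Complex.I) ^ k *
        (starRingEnd ℂ ((z.1 : ℂ) + z.2 * Complex.I)) ^ l
      ∂((gaussianReal 0 (1 / 2)).prod (gaussianReal 0 (1 / 2))) =
    ∫ z : ℂ, ((Real.pi⁻¹ * Real.exp (-‖z‖ ^ 2) : ℝ) : ℂ) * (z ^ k * starRingEnd ℂ z ^ l) := by
  have hv : (1 / 2 : NNReal) ≠ 0 := by norm_num
  have hm := measurable_gaussianPDF 0 (1 / 2)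
  have hm2 : Measurable fun z : ℝ × ℝ => gaussianPDF 0 (1 / 2) z.1 * gaussianPDF 0 (1 / 2) z.2 :=
    (hm.comp measurable_fst).mul (hm.comp measurable_snd)
  rw [gaussianReal_of_var_ne_zero 0 hv, prod_withDensity hm hm,
    integral_withDensity_eq_integral_toReal_smul hm2
      (ae_of_all _ fun z => ENNReal.mul_lt_top gaussianPDF_lt_top gaussianPDF_lt_top),
    ← Measure.volume_eq_prod,
    ← Complex.volume_preserving_equiv_real_prod.integral_comp']
  congr 1
  funext z
  have hz : ((z.re : ℂ) + z.im * Complex.I) = z := Complex.re_add_im z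
  simp only [Complex.measurableEquivRealProd_apply, hz]
  rw [Complex.real_smul, ENNReal.toReal_mul, toReal_gaussianPDF, toReal_gaussianPDF]
  congr 2
  simp only [gaussianPDFReal_def, sub_zero]
  have h1 : (2 * Real.pi * ((1 / 2 : NNReal) : ℝ)) = Real.pi := by push_cast; ring
  have h2 : (2 * ((1 / 2 : NNReal) : ℝ)) = 1 := by push_cast; ring
  rw [h1, h2, div_one, div_one, mul_mul_mul_comm, ← mul_inv, Real.mul_self_sqrt Real.pi_pos.le,
    ← Real.exp_add, ← Complex.normSq_eq_norm_sq, Complex.normSq_apply]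
  congr 2
  ring

/-- The rotation by π/(k - l) preserves the law and multiplies the integrand by -1. -/
theorem integral_complexGaussian_of_ne {k l : ℕ} (h : k ≠ l) :
    ∫ z : ℂ, ((Real.pi⁻¹ * Real.exp (-‖z‖ ^ 2) : ℝ) : ℂ) * (z ^ k * starRingEnd ℂ z ^ l) = 0 := by
  have hkl : (k : ℝ) - l ≠ 0 := by
    rw [sub_ne_zero]
    exact_mod_cast h
  set θ : ℝ := Real.pi / (k - l)
  set c : Circle := Circle.exp θ
  have hc : (c : ℂ) ^ k * starRingEnd ℂ (c : ℂ) ^ l = -1 := by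
    rw [← Circle.coe_inv_eq_conj, ← Circle.exp_neg, Circle.coe_exp, Circle.coe_exp,
      ← Complex.exp_nat_mul, ← Complex.exp_nat_mul, ← Complex.exp_add, ← Complex.exp_pi_mul_I]
    congr 1
    have h1 : (θ : ℂ) * (k - l) = Real.pi := by
      have : θ * (k - l) = Real.pi := by simp only [θ]; field_simp
      rw [← this]; push_cast; rfl
    rw [← h1]
    push_cast
    ring
  have hrot := (rotation c).measurePreserving.integral_comp
    (rotation c).toHomeomorph.measurableEmbedding
    (fun z : ℂ => ((Real.pi⁻¹ * Real.exp (-‖z‖ ^ 2) : ℝ) : ℂ) * (z ^ k * starRingEnd ℂ z ^ l))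
  have h2 : ∀ z : ℂ, ((Real.pi⁻¹ * Real.exp (-‖rotation c z‖ ^ 2) : ℝ) : ℂ) *
      (rotation c z ^ k * starRingEnd ℂ (rotation c z) ^ l) =
      -(((Real.pi⁻¹ * Real.exp (-‖z‖ ^ 2) : ℝ) : ℂ) * (z ^ k * starRingEnd ℂ z ^ l)) := by
    intro z
    rw [LinearIsometryEquiv.norm_map, rotation_apply, map_mul, mul_pow, mul_pow]
    linear_combination ((Real.pi⁻¹ * Real.exp (-‖z‖ ^ 2) : ℝ) : ℂ) *
      (z ^ k * starRingEnd ℂ z ^ l) * hc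
  simp only [h2, integral_neg] at hrot
  exact self_eq_neg.1 hrot.symm

theorem integral_complexGaussian_self (k : ℕ) :
    ∫ z : ℂ, ((Real.pi⁻¹ * Real.exp (-‖z‖ ^ 2) : ℝ) : ℂ) * (z ^ k * starRingEnd ℂ z ^ k) =
      k.factorial := by
  have h1 : ∀ z : ℂ, ((Real.pi⁻¹ * Real.exp (-‖z‖ ^ 2) : ℝ) : ℂ) * (z ^ k * starRingEnd ℂ z ^ k) =
      ((Real.pi⁻¹ * (‖z‖ ^ ((2 * k : ℕ) : ℝ) * Real.exp (-1 * ‖z‖ ^ (2 : ℝ))) : ℝ) : ℂ) := by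
    intro z
    rw [← mul_pow, Complex.mul_conj, Real.rpow_natCast, Real.rpow_two, Complex.normSq_eq_norm_sq]
    push_cast
    ring_nf
  simp only [h1]
  rw [integral_complex_ofReal, integral_const_mul, Complex.integral_rpow_mul_exp_neg_mul_rpow
    (by norm_num) (by have : (0 : ℝ) ≤ ((2 * k : ℕ) : ℝ) := Nat.cast_nonneg _
                      linarith) (by norm_num)]
  have h2 : (((2 * k : ℕ) : ℝ) + 2) / 2 = k + 1 := by push_cast; ring
  have hpi := Real.pi_ne_zero
  rw [h2, Real.Gamma_nat_eq_factorial, Real.one_rpow]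
  have h3 : Real.pi⁻¹ * (2 * Real.pi / 2 * 1 * (k.factorial : ℝ)) = k.factorial := by field_simp
  rw [h3]
  simp

theorem integral_complexGaussian (k l : ℕ) :
    ∫ z : ℝ × ℝ, ((z.1 : ℂ) + z.2 * Complex.I) ^ k *
        (starRingEnd ℂ ((z.1 : ℂ) + z.2 * Complex.I)) ^ l
      ∂((gaussianReal 0 (1 / 2)).prod (gaussianReal 0 (1 / 2))) =
    if k = l then (k.factorial : ℂ) else 0 := by
  rw [integral_complexGaussian_eq]
  split_ifs with h
  · rw [← h, integral_complexGaussian_self]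
  · exact integral_complexGaussian_of_ne h

/-! ### The law of each of the two variables. -/

/-- The pair partitions that join opposite signs are the bijections between the two signs. -/
def oppositePairingsEquiv {p : ℕ} (ε : Fin p → Bool) :
    {π : Equiv.Perm (Fin p) // π ∈ (pairings p).filter fun π => ∀ s, ε (π s) ≠ ε s} ≃
      ({s // ε s = false} ≃ {s // ε s = true}) where
  toFun π :=
    have h := Finset.mem_filter.1 π.2
    { toFun := fun s => ⟨π.1 s.1, by
        have := h.2 s.1
        rw [s.2] at this
        simpa using this⟩
      invFun := fun s => ⟨π.1 s.1, by
        have := h.2 s.1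
        rw [s.2] at this
        simpa using this⟩
      left_inv := fun s => Subtype.ext (mem_pairings.1 h.1 s.1).1
      right_inv := fun s => Subtype.ext (mem_pairings.1 h.1 s.1).1 }
  invFun e :=
    let f : Fin p → Fin p := fun s =>
      if h : ε s = false then (e ⟨s, h⟩).1 else (e.symm ⟨s, by simpa using h⟩).1
    have hf : ∀ s, f (f s) = s := by
      intro s
      by_cases h : ε s = false
      · have h1 : f s = (e ⟨s, h⟩).1 := dif_pos h
        have h2 : ¬ ε (f s) = false := by rw [h1, (e ⟨s, h⟩).2]; simp
        have h3 : f (f s) = (e.symm ⟨f s, by simpa using h2⟩).1 := dif_neg h2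
        rw [h3]
        simp only [h1, Subtype.coe_eta, Equiv.symm_apply_apply]
      · have h0 : ε s = true := by simpa using h
        have h1 : f s = (e.symm ⟨s, h0⟩).1 := dif_neg h
        have h2 : ε (f s) = false := by rw [h1, (e.symm ⟨s, h0⟩).2]
        have h3 : f (f s) = (e ⟨f s, h2⟩).1 := dif_pos h2
        rw [h3]
        simp only [h1, Subtype.coe_eta, Equiv.apply_symm_apply]
    have hε : ∀ s, ε (f s) ≠ ε s := by
      intro s
      by_cases h : ε s = false
      · have h1 : f s = (e ⟨s, h⟩).1 := dif_pos h
        rw [h1, (e ⟨s, h⟩).2, h]; simp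
      · have h0 : ε s = true := by simpa using h
        have h1 : f s = (e.symm ⟨s, h0⟩).1 := dif_neg h
        rw [h1, (e.symm ⟨s, h0⟩).2, h0]; simp
    ⟨⟨f, f, hf, hf⟩, Finset.mem_filter.2 ⟨mem_pairings.2 fun s =>
      ⟨hf s, fun h => hε s (congrArg ε h)⟩, hε⟩⟩
  left_inv π := by
    apply Subtype.ext
    ext s
    simp
  right_inv e := by
    ext s
    simp [s.2]

theorem card_oppositePairings {p : ℕ} (ε : Fin p → Bool) :
    ((pairings p).filter fun π => ∀ s, ε (π s) ≠ ε s).card =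
      if Fintype.card {s // ε s = false} = Fintype.card {s // ε s = true} then
        (Fintype.card {s // ε s = false}).factorial else 0 := by
  rw [← Fintype.card_coe, Fintype.card_congr (oppositePairingsEquiv ε)]
  split_ifs with h
  · exact Fintype.card_equiv (Fintype.equivOfCardEq h)
  · rw [Fintype.card_eq_zero_iff]
    exact ⟨fun e => h (Fintype.card_congr e)⟩

/-- For a constant label, the phase vanishes along all closed paths. -/
theorem fractExp_const_label {p : ℕ} (a : Fin 2) (π : Equiv.Perm (Fin p))
    (x : Option {s : Fin p // s < π s} → ℝ) :
    fractExp Real.pi (labelCoeff fun _ : Fin p => a) (pairingForm π) x = 1 := by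
  have hform : ∀ v, pairingForm π 0 v = pairingForm π (Fin.last p) v := by
    intro v
    cases v <;> simp [pairingForm, Fin.castSucc_lt_last]
  -- With a constant second label only the coefficients -1 at 0 and 1 at the last point survive;
  -- with the first label all vanish.
  have h : ∀ g : Fin (p + 1) → ℝ, g 0 = g (Fin.last p) →
      ∑ r, (labelCoeff (fun _ : Fin p => a) r : ℝ) * g r = 0 := by
    intro g hg
    simp only [labelCoeff, Int.cast_sum, Finset.sum_mul]
    rw [Finset.sum_comm]
    by_cases ha : a = 1
    · simp only [ha, if_true, Int.cast_sub, Int.cast_ite, Int.cast_one, Int.cast_zero, sub_mul,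
        ite_mul, one_mul, zero_mul, Finset.sum_sub_distrib, Finset.sum_ite_eq', Finset.mem_univ]
      have h2 := Fin.sum_univ_succ g
      have h3 := Fin.sum_univ_castSucc g
      linarith
    · simp [ha]
  rw [fractExp, h (fun r => Int.fract (∑ v, (pairingForm π r v : ℝ) * x v))]
  · simp
  · simp only [hform]

theorem fractExpIntegral_const_label {p : ℕ} (a : Fin 2) (π : Equiv.Perm (Fin p)) :
    fractExpIntegral Real.pi (labelCoeff fun _ : Fin p => a) (pairingForm π) = 1 := by
  have h : fractExpIntegral Real.pi (labelCoeff fun _ : Fin p => a) (pairingForm π) =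
      ∫ x in Set.Icc (0 : Option {s : Fin p // s < π s} → ℝ) 1,
        fractExp Real.pi (labelCoeff fun _ : Fin p => a) (pairingForm π) x := rfl
  rw [h]
  simp only [fractExp_const_label]
  rw [setIntegral_const, Measure.real, Real.volume_Icc_pi_toReal zero_le_one]
  simp

/-- Every integral is 1, so what is left is the number of bijections between the letters and the
adjoints. -/
theorem limitMoment_const_label {p : ℕ} (a : Fin 2) (ε : Fin p → Bool) :
    limitMoment (fun _ => a) ε =
      if Fintype.card {s // ε s = false} = Fintype.card {s // ε s = true} then
        ((Fintype.card {s // ε s = false}).factorial : ℂ) else 0 := by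
  have h := card_oppositePairings ε
  simp only [limitMoment, fractExpIntegral_const_label, true_and, Finset.sum_const, h]
  split_ifs <;> simp

theorem isStdComplexGaussian_modelVar (a : Fin 2) :
    IsStdComplexGaussian modelProbSpace (modelVar a) := by
  refine ⟨modelVar_mul_star a, fun k l => ?_⟩
  rw [integral_complexGaussian]
  set w : List (Fin 2 × Bool) := List.replicate k (a, false) ++ List.replicate l (a, true)
  have hw : modelVar a ^ k * star (modelVar a) ^ l =
      evalWord ![modelVar 0, modelVar 1] w := by
    have h : ![modelVar 0, modelVar 1] a = modelVar a := by fin_cases a <;> rfl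
    simp [w, evalWord, h]
  have ha : (fun s => (w.get s).1) = fun _ => a := by
    funext s
    have hs := List.get_mem w s
    rcases List.mem_append.1 hs with h | h <;> rw [List.eq_of_mem_replicate h]
  have hcard : ∀ b : Bool, Fintype.card {s : Fin w.length // (w.get s).2 = b} =
      (w.map fun x => if x.2 = b then 1 else 0).sum := by
    intro b
    rw [Fintype.card_subtype, Finset.card_filter]
    conv_rhs => rw [← List.ofFn_get w, List.map_ofFn, List.sum_ofFn]
    rfl
  rw [hw, state_evalWord_modelVar, ha, limitMoment_const_label, hcard, hcard]
  simp [w]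

/-! ### The theorem. -/

theorem matchedPairings_eq (w : List (Fin 2 × Bool)) :
    matchedPairings w = (pairings w.length).filter fun π =>
      ∀ s, (w.get (π s)).1 = (w.get s).1 ∧ (w.get (π s)).2 ≠ (w.get s).2 := by
  rw [matchedPairings, pairings, Finset.filter_filter]
  refine Finset.filter_congr fun π _ => ?_
  simp only [← forall_and, and_assoc]

theorem theorem4p1 {Ω : Type*} [MeasurableSpace Ω] (P : Measure Ω) [IsProbabilityMeasure P]
    (τ : ℤ → Ω → ℝ) (hτ : AssumptionI P τ) :
    (∀ n : ℕ, HasAllMoments P (((Real.sqrt n : ℝ) : ℂ)⁻¹ • toeplitz τ n)) ∧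
    ∃ (𝒜 : NCProbSpace) (N N' : 𝒜.carrier),
      IsStdComplexGaussian 𝒜 N ∧ IsStdComplexGaussian 𝒜 N' ∧
      ConvergesInStarDist (expTrace P)
        (fun n (_ : Unit) => ((Real.sqrt n : ℝ) : ℂ)⁻¹ • toeplitz τ n)
        𝒜.state (fun _ : Unit => ((Real.sqrt 2 : ℝ) : ℂ)⁻¹ • (N + N')) ∧
      (∀ w : List (Fin 2 × Bool), 𝒜.state (evalWord ![N, N'] w) =
        ∑ π ∈ matchedPairings w,
          fractExpIntegral Real.pi (phaseCoeff w) (pairingForm π)) ∧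
      (∀ w : List (Fin 2 × Bool), ‖𝒜.state (evalWord ![N, N'] w)‖ ≤
        ∫ x : ℝ, x ^ w.length ∂(gaussianReal 0 1)) := by
  refine ⟨fun n => hasAllMoments_smul_toeplitz hτ n _, modelProbSpace, modelVar 0, modelVar 1,
    isStdComplexGaussian_modelVar 0, isStdComplexGaussian_modelVar 1, fun w => ?_, fun w => ?_,
    fun w => ?_⟩
  · rw [state_evalWord_sum_modelVar]
    exact tendsto_expTrace_toeplitz hτ w
  · rw [state_evalWord_modelVar, matchedPairings_eq]
    rfl
  · rw [state_evalWord_modelVar]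
    exact norm_limitMoment_le _ _
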